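/- For a family of languages LAN, let $\pi(\mathrm{LAN})$ be the class of groups $G$ that have, for some finite generating tuple $S$, a presentation $(G,S)=\langle S\mid R\rangle$ with $R\subseteq (S\cup S^{-1})^*$ a language in LAN. Let REC and RE be the families of recursive and of recursively enumerable languages, and let EDT0L be the family of languages $L\subseteq A^*$ for which there are a finite alphabet $N$ disjoint from $A$, a word $w_0\in (A\cup N)^*$ and a finite set $\Phi$ of endomorphisms of the free monoid $(A\cup N)^*$ such that $L$ is the set of words in $A^*$ of the form $\varphi_r(\cdots\varphi_1(w_0)\cdots)$ with $r\ge 0$ and $\varphi_1,\dots,\varphi_r\in\Phi$. Write $[x,y]=x^{-1}y^{-1}xy$ and $[x_1,\dots,x_{m+1}]=[[x_1,\dots,x_m],x_{m+1}]$. Let $$G=\langle a,b \mid [b_i,b_j,a]=1,\ [b_i,b_j,b]=1\ \ (i,j\in\mathbb Z)\rangle,\qquad b_i=a^{-i}ba^i,$$ be Hall's group, let $f_n=[b,\underbrace{a,\dots,a}_{n},b]$, and let $p_0=3,\ p_1=5,\ p_2=7,\dots$ be the odd primes. Let $\tau$ be the running time of an effective enumeration of all Turing machines: $\tau(n)\ge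 1$ is the number of steps after which the $n$-th machine, run without input, halts, and is undefined if it does not halt. (All that matters is that $\tau$ is a partial function from $\mathbb N$ to the positive integers such that $\{(n,t):\tau(n)=t\}$ is decidable and the domain of $\tau$ is undecidable; the statement holds for every such $\tau$, and such $\tau$ exist.) Let $H$ be the quotient of $G$ by the relations $f_{p_n}=f_{p_n^{\tau(n)}}$, for all $n$ in the domain of $\tau$. Then $H$ is recursively presented, that is, $H\in\pi(\mathrm{REC})$; no algorithm can, on input $n\ge 1$, produce a finite presentation of the nilpotent quotient $H/\gamma_n(H)$ marked by the images of $a$ and $b$; and $H$ admits no EDT0L presentation, that is, $H\notin\pi(\mathrm{EDT0L})$. Consequently $$\pi(\mathrm{EDT0L})\subsetneq\pi(\mathrm{REC})=\pi(\mathrm{RE}).$$ -/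

import Mathlib

universe u

namespace LangPres

/-! ### Families of languages -/

/-- A family of languages: to each (effectively coded) alphabet it assigns a set of languages. -/
abbrev LanguageFamily := (A : Type) → [Primcodable A] → Set (Language A)

/-- The recursive languages. -/
def REC : LanguageFamily := fun A _ => {L | ComputablePred fun w : List A => w ∈ L}

/-- The recursively enumerable languages. -/
def RE : LanguageFamily := fun A _ => {L | REPred fun w : List A => w ∈ L}

/-- A DT0L system over `B`: a seed word and finitely many monoid endomorphisms of `B*`, each
given by its values on the letters. -/
structure DT0LSystem (B : Type) where
  seed : List B
  morphisms : List (B → List B)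

/-- The endomorphism of the free monoid `B*` determined by the images of the letters. -/
def applyMorphism {B : Type} (h : B → List B) (w : List B) : List B := w.flatMap h

/-- The words obtained from the seed by applying a finite chain of morphisms of the system, with
repetitions allowed and in any order. -/
def DT0LSystem.language {B : Type} (D : DT0LSystem B) : Language B :=
  {w | ∃ c : List (B → List B), (∀ h ∈ c, h ∈ D.morphisms) ∧
    w = c.foldl (fun u h => applyMorphism h u) D.seed}

/-- The EDT0L languages over `A`: for a finite alphabet of nonterminals and a DT0L system over the
disjoint union of `A` with it, the words of the DT0L language all of whose letters lie in `A`. -/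
def EDT0L : LanguageFamily := fun A _ =>
  {L | ∃ (m : ℕ) (D : DT0LSystem (A ⊕ Fin m)),
    L = {w : List A | w.map Sum.inl ∈ D.language}}

/-! ### Presentations in a family of languages -/

/-- `⟨s | R⟩` is a presentation of the marked group `(G, s)`, where `R` is a set of words over
`S ∪ S⁻¹`; the letter `(i, true)` is the `i`-th generator and `(i, false)` its inverse. -/
def IsMarkedPresentation {G : Type*} [Group G] {k : ℕ} (s : Fin k → G)
    (R : Set (List (Fin k × Bool))) : Prop :=
  Subgroup.closure (Set.range s) = ⊤ ∧
    Subgroup.normalClosure (FreeGroup.mk '' R) = (FreeGroup.lift s).ker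

/-- The class `π(LAN)` of the groups which, for some finite marking, have a presentation whose set
of relators is a language in `LAN`. -/
def presented (LAN : LanguageFamily) : Set GrpCat.{u} :=
  {G | ∃ (k : ℕ) (s : Fin k → G) (R : Language (Fin k × Bool)),
    R ∈ LAN (Fin k × Bool) ∧ IsMarkedPresentation s R}

/-- The nilpotent quotients of the marked group `(G, s)` are computable: some algorithm, on input
`n`, produces a finite presentation of the marked group `(G/γₙ₊₁(G), s)`, where `γ₁(G) = G`; recall
that `(⊤ : Subgroup G).lowerCentralSeries 0 = ⊤`. -/
def ComputableNilpotentQuotients {G : Type*} [Group G] {k : ℕ} (s : Fin k → G) : Prop :=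
  ∃ F : ℕ → List (List (Fin k × Bool)), Computable F ∧
    ∀ n, IsMarkedPresentation (fun i => (s i : G ⧸ (⊤ : Subgroup G).lowerCentralSeries n))
      {r | r ∈ F n}

/-! ### Hall's group and its quotients -/

/-- The commutator `[x, y] = x⁻¹ y⁻¹ x y`. -/
def comm {K : Type*} [Group K] (x y : K) : K := x⁻¹ * y⁻¹ * x * y

/-- The free generator `a`. -/
def genA : FreeGroup (Fin 2) := FreeGroup.of 0

/-- The free generator `b`. -/
def genB : FreeGroup (Fin 2) := FreeGroup.of 1

/-- `b_i = a⁻ⁱ b aⁱ`. -/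
def conjB (i : ℤ) : FreeGroup (Fin 2) := genA ^ (-i) * genB * genA ^ i

/-- Relators of Hall's group: `[b_i, b_j, a]` and `[b_i, b_j, b]` for all integers `i`, `j`. -/
def hallRelators : Set (FreeGroup (Fin 2)) :=
  {r | ∃ i j : ℤ, r = comm (comm (conjB i) (conjB j)) genA ∨
    r = comm (comm (conjB i) (conjB j)) genB}

/-- The left-normed commutator `[b, a, …, a]` with `n` letters `a`. -/
def iterComm : ℕ → FreeGroup (Fin 2)
  | 0 => genB
  | n + 1 => comm (iterComm n) genA

/-- `f_n = [b, a, …, a, b]` with `n` letters `a`. -/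
def fElt (n : ℕ) : FreeGroup (Fin 2) := comm (iterComm n) genB

/-- The sequence of the odd primes: `3, 5, 7, …`, indexed from `0`. -/
noncomputable def oddPrime (n : ℕ) : ℕ := Nat.nth Nat.Prime (n + 1)

/-- The relators expressing `f_{p_n} = f_{p_n ^ t}` for each `n` such that the `n`-th machine
halts, after exactly `t` steps (`t ∈ τ n`). -/
def haltingRelators (τ : ℕ →. ℕ) : Set (FreeGroup (Fin 2)) :=
  {r | ∃ n t : ℕ, t ∈ τ n ∧ r = fElt (oddPrime n) * (fElt (oddPrime n ^ t))⁻¹}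

/-- The quotient `H` of Hall's group by the relations `f_{p_n} = f_{p_n ^ t}`. -/
abbrev hallQuotient (τ : ℕ →. ℕ) : Type :=
  PresentedGroup (hallRelators ∪ haltingRelators τ)

/-- The marking of `hallQuotient τ` by the images of `a` and `b`. -/
def hallMarking (τ : ℕ →. ℕ) : Fin 2 → hallQuotient τ := fun i => PresentedGroup.of i

/-- `τ` behaves as the running time of an effective enumeration of all Turing machines, started
without input: `τ n` is the number of steps after which the `n`-th machine halts, and is undefined
if it does not halt. -/
structure IsHaltingTime (τ : ℕ →. ℕ) : Prop where
  one_le : ∀ n t, t ∈ τ n → 1 ≤ t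
  decidable_graph : ComputablePred fun q : ℕ × ℕ => q.2 ∈ τ q.1
  undecidable_dom : ¬ ComputablePred fun n => (τ n).Dom

/-- A concrete running time, for Mathlib's enumeration of the programs of partial recursive
functions: the least `t` for which the clocked evaluation of the `n`-th program on input `0`
returns within time `t`. -/
def codeHaltingTime (n : ℕ) : Part ℕ :=
  Nat.rfind (PFun.lift fun t =>
    (Nat.Partrec.Code.evaln t (Denumerable.ofNat Nat.Partrec.Code n) 0).isSome)

theorem codeHaltingTime_isHaltingTime : IsHaltingTime codeHaltingTime := by
  have key : ∀ n t, t ∈ codeHaltingTime n ↔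
      ((Nat.Partrec.Code.evaln t (Denumerable.ofNat Nat.Partrec.Code n) 0).isSome = true ∧
       (Nat.Partrec.Code.evaln (t - 1) (Denumerable.ofNat Nat.Partrec.Code n) 0).isSome = false) := by
    intro n t
    unfold codeHaltingTime
    rw [Nat.mem_rfind]
    simp only [PFun.coe_val, Part.mem_some_iff]
    constructor
    · rintro ⟨h1, h2⟩
      refine ⟨h1.symm, ?_⟩
      rcases Nat.eq_zero_or_pos t with rfl | ht
      · simp [Nat.Partrec.Code.evaln] at h1
      · exact (h2 (by omega : t - 1 < t)).symm
    · rintro ⟨h1, h2⟩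
      refine ⟨h1.symm, fun {m} hm => ?_⟩
      by_contra hne
      have h3 : (Nat.Partrec.Code.evaln m (Denumerable.ofNat Nat.Partrec.Code n) 0).isSome = true := by
        revert hne
        cases (Nat.Partrec.Code.evaln m (Denumerable.ofNat Nat.Partrec.Code n) 0).isSome <;> simp
      obtain ⟨x, hx⟩ := Option.isSome_iff_exists.1 h3
      have := Nat.Partrec.Code.evaln_mono (by omega : m ≤ t - 1) (Option.mem_def.2 hx)
      rw [Option.mem_def.1 this] at h2
      simp at h2
  refine ⟨?_, ?_, ?_⟩
  · intro n t ht
    rcases Nat.eq_zero_or_pos t with rfl | h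
    · have := ((key n 0).1 ht).1
      simp [Nat.Partrec.Code.evaln] at this
    · exact h
  · have hp : ∀ g : ℕ → ℕ, Primrec g → Primrec fun q : ℕ × ℕ =>
        (Nat.Partrec.Code.evaln (g q.2) (Denumerable.ofNat Nat.Partrec.Code q.1) 0).isSome := by
      intro g hg
      exact Primrec.option_isSome.comp (Nat.Partrec.Code.primrec_evaln.comp
        (Primrec.pair (Primrec.pair (hg.comp Primrec.snd)
          ((Primrec.ofNat Nat.Partrec.Code).comp Primrec.fst)) (Primrec.const 0)))
    have h1 := hp id Primrec.id
    have h2 := hp Nat.pred Primrec.pred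
    have h3 := Primrec.and.comp h1 (Primrec.not.comp h2)
    refine ComputablePred.computable_iff.2 ⟨_, h3.to_comp, ?_⟩
    funext q
    rw [key]
    simp
  · intro h
    apply ComputablePred.halting_problem 0
    have h4 := h.of_eq (q := fun n => (Nat.Partrec.Code.eval
      (Denumerable.ofNat Nat.Partrec.Code n) 0).Dom) (fun n => by
        constructor
        · intro hd
          obtain ⟨t, ht⟩ := Part.dom_iff_mem.1 hd
          obtain ⟨x, hx⟩ := Option.isSome_iff_exists.1 ((key n t).1 ht).1
          exact Part.dom_iff_mem.2 ⟨x, Nat.Partrec.Code.evaln_sound (Option.mem_def.2 hx)⟩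
        · intro hd
          obtain ⟨x, hx⟩ := Part.dom_iff_mem.1 hd
          obtain ⟨k, hk⟩ := Nat.Partrec.Code.evaln_complete.1 hx
          unfold codeHaltingTime
          exact Nat.rfind_dom.2 ⟨k, by simp [Option.mem_def.1 hk], fun _ => trivial⟩)
    obtain ⟨f, hf, hf2⟩ := ComputablePred.computable_iff.1 h4
    refine ComputablePred.computable_iff.2
      ⟨fun c => f (Encodable.encode c), hf.comp Computable.encode, ?_⟩
    funext c
    have := congrFun hf2 (Encodable.encode c)
    simpa using this

end LangPres

namespace LangPres

universe v

/-! ### Computability -/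

section Computability

variable {α β : Type*} [Primcodable α] [Primcodable β]

/-! Both negative statements rest on one reduction to the halting problem. Let p be the n-th odd
prime. If the n-th machine halts after t ≥ 2 steps, then f_p = f_{p^t} in H, so f_p dies in every
quotient where [b, a, …, a] with p² letters a dies. If it never halts, f_p survives in some finite
nilpotent quotient where that commutator dies (`exists_nilpotent_quotient`). So non-halting means: 1
is not the running time, and some finite permutation representation of H kills the long commutator
but not f_p. Everything here can be checked on explicit permutations, except that they define a
representation of H. If that fact has decidable certificates, available at least for the
representations through finite nilpotent quotients, then non-halting is recursively enumerable and
halting becomes decidable (`false_of_certificates`). Finite presentations of the quotients H/γ_n(H)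
give such certificates: the relators of one of them act trivially. An EDT0L presentation also gives
certificates. Evaluating φ(u) under an assignment of self-maps to letters is evaluating u under the
pulled-back assignment. On a finite set there are finitely many assignments, so a finite family
closed under pullback controls the infinitely many relators through the seed alone. Nonterminals get
a constant map, which makes every word containing one non-injective and so distinguishable from a
relator (`exists_EDT0LCertificate`, `EDT0LCertificate.prod_eq_one`). For the positive part, H has
recursively enumerable relators, and Craig's padding trick makes any such set recursive
(`presented_RE_subset_REC`). -/

theorem primrecPred_forall_mem {f : α → List β} {p : α → β → Prop} (hf : Primrec f)
    (hp : PrimrecRel p) : PrimrecPred fun a => ∀ b ∈ f a, p a b :=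
  (PrimrecRel.forall_mem_list (R := fun i a => p a i) hp.swap).comp hf Primrec.id

theorem primrecPred_exists_mem {f : α → List β} {p : α → β → Prop} (hf : Primrec f)
    (hp : PrimrecRel p) : PrimrecPred fun a => ∃ b ∈ f a, p a b :=
  (PrimrecRel.exists_mem_list (R := fun i a => p a i) hp.swap).comp hf Primrec.id

theorem primrecPred_forall_lt {f : α → ℕ} {p : α → ℕ → Prop} (hf : Primrec f)
    (hp : PrimrecRel p) : PrimrecPred fun a => ∀ i < f a, p a i :=
  (primrecPred_forall_mem (Primrec.list_range.comp hf) hp).of_eq (by simp)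

theorem primrecPred_exists_lt {f : α → ℕ} {p : α → ℕ → Prop} (hf : Primrec f)
    (hp : PrimrecRel p) : PrimrecPred fun a => ∃ i < f a, p a i :=
  (primrecPred_exists_mem (Primrec.list_range.comp hf) hp).of_eq (by simp)

theorem primrecPred_forall_finite {ι : Type*} [Finite ι] {p : ι → α → Prop}
    (hp : ∀ i, PrimrecPred (p i)) : PrimrecPred fun a => ∀ i, p i a := by
  classical
  have key : ∀ l : List ι, PrimrecPred fun a => ∀ i ∈ l, p i a := by
    intro l
    induction l with
    | nil => exact (Primrec.primrecPred (p := fun _ : α => True) (Primrec.const true)).of_eq (by simp)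
    | cons i l ih => exact ((hp i).and ih).of_eq (by simp)
  have := Fintype.ofFinite ι
  exact (key Finset.univ.toList).of_eq (by simp)

theorem computablePred_comp {p : β → Prop} {f : α → β} (hp : ComputablePred p)
    (hf : Computable f) : ComputablePred fun a => p (f a) := by
  obtain ⟨g, hg, rfl⟩ := ComputablePred.computable_iff.1 hp
  exact ComputablePred.computable_iff.2 ⟨_, hg.comp hf, rfl⟩

theorem computablePred_and {p q : α → Prop} (hp : ComputablePred p) (hq : ComputablePred q) :
    ComputablePred fun a => p a ∧ q a := by
  obtain ⟨f, hf, rfl⟩ := ComputablePred.computable_iff.1 hp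
  obtain ⟨g, hg, rfl⟩ := ComputablePred.computable_iff.1 hq
  exact ComputablePred.computable_iff.2
    ⟨fun a => f a && g a, Primrec.and.to_comp.comp hf hg, by funext a; simp⟩

theorem computablePred_or {p q : α → Prop} (hp : ComputablePred p) (hq : ComputablePred q) :
    ComputablePred fun a => p a ∨ q a := by
  obtain ⟨f, hf, rfl⟩ := ComputablePred.computable_iff.1 hp
  obtain ⟨g, hg, rfl⟩ := ComputablePred.computable_iff.1 hq
  exact ComputablePred.computable_iff.2
    ⟨fun a => f a || g a, Primrec.or.to_comp.comp hf hg, by funext a; simp⟩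

theorem rePred_exists {p : α → β → Prop} (hp : ComputablePred fun q : α × β => p q.1 q.2) :
    REPred fun a => ∃ b, p a b := by
  obtain ⟨g, hg, hpg⟩ := ComputablePred.computable_iff.1 hp
  have hpg' : ∀ a b, p a b ↔ g (a, b) = true := fun a b => iff_of_eq (congrFun hpg (a, b))
  have hc : Computable₂ fun (a : α) (n : ℕ) =>
      ((Encodable.decode (α := β) n).map fun b => g (a, b)).getD false := by
    refine Computable.option_getD (Computable.option_map (Computable.decode.comp Computable.snd) ?_)
      (Computable.const false)
    exact hg.comp (Computable.pair (Computable.fst.comp Computable.fst) Computable.snd)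
  refine (Partrec.dom_re (Partrec.rfind hc.partrec₂)).of_eq fun a => ?_
  rw [Nat.rfind_dom]
  constructor
  · rintro ⟨n, hn, -⟩
    simp only [PFun.coe_val, Part.mem_some_iff] at hn
    cases hd : Encodable.decode (α := β) n with
    | none => simp [hd] at hn
    | some b => exact ⟨b, (hpg' a b).2 (by simpa [hd] using hn.symm)⟩
  · rintro ⟨b, hb⟩
    exact ⟨Encodable.encode b, by simp [(hpg' a b).1 hb], fun _ => trivial⟩

/-- The stage is the clock of a bounded evaluation of a program that semidecides `p`. -/
theorem rePred_iff_exists_stage {p : α → Prop} (hp : REPred p) :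
    ∃ f : ℕ → α → Bool, Primrec₂ f ∧ ∀ a, p a ↔ ∃ n, f n a = true := by
  have hp' : Nat.Partrec _ := hp
  obtain ⟨c, hc⟩ := Nat.Partrec.Code.exists_code.1 hp'
  refine ⟨fun n a => (Nat.Partrec.Code.evaln n c (Encodable.encode a)).isSome, ?_, fun a => ?_⟩
  · exact Primrec.option_isSome.comp (Nat.Partrec.Code.primrec_evaln.comp
      (Primrec.pair (Primrec.pair Primrec.fst (Primrec.const c))
        (Primrec.encode.comp Primrec.snd)))
  · have h1 : p a ↔ (c.eval (Encodable.encode a)).Dom := by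
      rw [hc]; simp [Part.assert]
    rw [h1, Part.dom_iff_mem]
    simp only [Nat.Partrec.Code.evaln_complete, Option.isSome_iff_exists, Option.mem_def]
    exact exists_comm

end Computability

/-! ### Presentations and families of languages -/

theorem IsMarkedPresentation.map_mulEquiv {G : Type*} {H : Type*} [Group G] [Group H] {k : ℕ}
    {s : Fin k → G} {R : Set (List (Fin k × Bool))} (h : IsMarkedPresentation s R) (e : G ≃* H) :
    IsMarkedPresentation (e ∘ s) R := by
  obtain ⟨h1, h2⟩ := h
  have hl : FreeGroup.lift (e ∘ s) = e.toMonoidHom.comp (FreeGroup.lift s) := by ext; simp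
  refine ⟨?_, ?_⟩
  · rw [Set.range_comp]
    have := MonoidHom.map_closure e.toMonoidHom (Set.range s)
    rw [h1] at this
    rw [show (⇑e '' Set.range s) = ⇑e.toMonoidHom '' Set.range s from rfl, ← this]
    exact Subgroup.map_top_of_surjective _ e.surjective
  · rw [h2, hl]
    ext x
    simp [MonoidHom.mem_ker]

theorem presented_of_mulEquiv {LAN : LanguageFamily} {G : Type u} {H : Type v} [Group G] [Group H]
    (e : G ≃* H) (h : GrpCat.of G ∈ presented LAN) : GrpCat.of H ∈ presented LAN := by
  obtain ⟨k, s, R, hR, hp⟩ := h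
  exact ⟨k, e ∘ s, R, hR, hp.map_mulEquiv e⟩

theorem presented_mono {L₁ L₂ : LanguageFamily}
    (h : ∀ (k : ℕ) (R : Language (Fin k × Bool)), R ∈ L₁ (Fin k × Bool) → R ∈ L₂ (Fin k × Bool)) :
    presented.{u} L₁ ⊆ presented L₂ := by
  rintro G ⟨k, s, R, hR, hp⟩
  exact ⟨k, s, R, h k R hR, hp⟩

theorem presented_REC_subset_RE : presented.{u} REC ⊆ presented RE :=
  presented_mono fun _ _ h => ComputablePred.to_re h

/-- The word `(s s⁻¹)ⁿ`, where `s` is the first generator. -/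
def padding (k n : ℕ) : List (Fin (k + 1) × Bool) :=
  (List.range n).flatMap fun _ => [(0, true), (0, false)]

theorem mk_padding (k n : ℕ) : FreeGroup.mk (padding k n) = 1 := by
  induction n with
  | zero => rfl
  | succ n ih =>
    have : padding k (n + 1) = padding k n ++ [(0, true), (0, false)] := by
      simp [padding, List.range_succ]
    rw [this, ← FreeGroup.mul_mk, ih, one_mul]
    exact FreeGroup.Red.exact.2 ⟨[], FreeGroup.Red.Step.to_red (FreeGroup.Red.Step.not (L₁ := [])), .refl⟩

theorem length_padding (k n : ℕ) : (padding k n).length = 2 * n := by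
  simp [padding, List.length_flatMap, mul_comm]

theorem primrec_padding (k : ℕ) : Primrec (padding k) :=
  Primrec.list_flatMap Primrec.list_range (Primrec.const _)

/-- Craig's trick: a relator recognised at stage n is replaced by itself followed by n cancelling
pairs. The group element is unchanged, and the length of the padded word bounds the stage, so
membership becomes a bounded search. -/
theorem presented_RE_subset_REC : presented.{u} RE ⊆ presented REC := by
  rintro G ⟨k, s, R, hR, hgen, hker⟩
  -- Without generators there is no letter to pad with, but then the free group is trivial and no
  -- relators are needed.
  rcases k with _ | k
  · refine ⟨0, s, (∅ : Set (List (Fin 0 × Bool))), ?_, hgen, ?_⟩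
    · exact (Primrec.primrecPred (p := fun _ => False)
        (Primrec.const false)).computablePred.of_eq fun w => Iff.rfl
    · ext x
      rw [Subsingleton.elim x 1]
      simp [one_mem]
  obtain ⟨f, hf, hRf⟩ := rePred_iff_exists_stage hR
  refine ⟨k + 1, s, {u | ∃ n w, f n w = true ∧ u = w ++ padding k n}, ?_, hgen, ?_⟩
  · have h1 : PrimrecPred fun u : List (Fin (k + 1) × Bool) =>
        ∃ n < u.length + 1, ∃ j < u.length + 1,
          f n (u.take j) = true ∧ u = u.take j ++ padding k n := by
      refine primrecPred_exists_lt (Primrec.succ.comp Primrec.list_length) ?_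
      refine primrecPred_exists_lt
        (Primrec.succ.comp (Primrec.list_length.comp Primrec.fst)) ?_
      have ht : Primrec fun q : (List (Fin (k + 1) × Bool) × ℕ) × ℕ => q.1.1.take q.2 :=
        Primrec.list_take.comp Primrec.snd (Primrec.fst.comp Primrec.fst)
      refine PrimrecPred.and ?_ ?_
      · exact Primrec.eq.comp (hf.comp (Primrec.snd.comp Primrec.fst) ht) (Primrec.const true)
      · exact Primrec.eq.comp (Primrec.fst.comp Primrec.fst)
          (Primrec.list_append.comp ht ((primrec_padding k).comp (Primrec.snd.comp Primrec.fst)))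
    refine h1.computablePred.of_eq fun u => ?_
    constructor
    · rintro ⟨n, -, j, -, h2, h3⟩
      exact ⟨n, _, h2, h3⟩
    · rintro ⟨n, w, h2, rfl⟩
      refine ⟨n, ?_, w.length, ?_, ?_⟩
      · simp [length_padding]; omega
      · simp
      · simp [h2]
  · rw [← hker]
    congr 1
    ext x
    constructor
    · rintro ⟨_, ⟨n, w, h1, rfl⟩, rfl⟩
      refine ⟨w, (hRf w).2 ⟨n, h1⟩, ?_⟩
      rw [← FreeGroup.mul_mk, mk_padding, mul_one]
    · rintro ⟨w, hw, rfl⟩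
      obtain ⟨n, hn⟩ := (hRf w).1 hw
      refine ⟨_, ⟨n, w, hn, rfl⟩, ?_⟩
      rw [← FreeGroup.mul_mk, mk_padding, mul_one]

/-- The `i`-th morphism of a DT0L system, or the identity if there is none. -/
def DT0LSystem.morphism {B : Type} (D : DT0LSystem B) (i : ℕ) (b : B) : List B :=
  ((D.morphisms.map fun h => h b)[i]?).getD [b]

theorem DT0LSystem.morphism_mem_or {B : Type} (D : DT0LSystem B) (i : ℕ) :
    D.morphism i ∈ D.morphisms ∨ D.morphism i = fun b => [b] := by
  rcases lt_or_ge i D.morphisms.length with hi | hi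
  · left
    convert List.getElem_mem hi using 1
    funext b
    simp [morphism, hi]
  · right
    funext b
    simp [morphism, hi]

theorem DT0LSystem.exists_morphism_eq {B : Type} (D : DT0LSystem B) {h : B → List B}
    (hh : h ∈ D.morphisms) : ∃ i < D.morphisms.length, D.morphism i = h := by
  obtain ⟨i, hi, rfl⟩ := List.getElem_of_mem hh
  exact ⟨i, hi, by funext b; simp [morphism, hi]⟩

/-- Chains of functions are replaced by lists of indices, which can be enumerated. Out-of-range
indices act as the identity, so no list has to be excluded. -/
theorem DT0LSystem.mem_language_iff {B : Type} (D : DT0LSystem B) (w : List B) :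
    w ∈ D.language ↔
      ∃ c : List ℕ, w = c.foldl (fun u i => applyMorphism (D.morphism i) u) D.seed := by
  constructor
  · rintro ⟨c, hc, rfl⟩
    generalize D.seed = s
    induction c generalizing s with
    | nil => exact ⟨[], rfl⟩
    | cons h c ih =>
      obtain ⟨i, -, hi⟩ := D.exists_morphism_eq (hc h (by simp))
      obtain ⟨l, hl⟩ := ih (fun h' hh' => hc h' (by simp [hh'])) (applyMorphism h s)
      exact ⟨i :: l, by simp [hl, hi]⟩
  · rintro ⟨l, rfl⟩
    change ∃ c : List (B → List B), _
    generalize D.seed = s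
    induction l generalizing s with
    | nil => exact ⟨[], by simp, rfl⟩
    | cons i l ih =>
      obtain ⟨c, hc, h⟩ := ih (applyMorphism (D.morphism i) s)
      rcases D.morphism_mem_or i with hi | hi
      · exact ⟨D.morphism i :: c, by simpa [hi] using hc, by simpa using h⟩
      · exact ⟨c, hc, by simpa [hi, applyMorphism] using h⟩

theorem DT0LSystem.primrec_morphism {B : Type} [Primcodable B] [Finite B] (D : DT0LSystem B) :
    Primrec₂ D.morphism :=
  Primrec.option_getD.comp
    (Primrec.list_getElem?.comp ((Primrec.dom_finite fun b => D.morphisms.map fun h => h b).comp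
      Primrec.snd) Primrec.fst)
    ((Primrec.dom_finite fun b => [b]).comp Primrec.snd)

theorem EDT0L_subset_RE {A : Type} [Primcodable A] [Finite A] : EDT0L A ⊆ RE A := by
  rintro L ⟨m, D, rfl⟩
  have h1 : PrimrecPred fun q : List A × List ℕ =>
      q.1.map Sum.inl = q.2.foldl (fun u i => applyMorphism (D.morphism i) u) D.seed := by
    refine Primrec.eq.comp (Primrec.list_map Primrec.fst (Primrec.sumInl.comp Primrec.snd).to₂)
      (Primrec.list_foldl (h := fun _ x => applyMorphism (D.morphism x.2) x.1) Primrec.snd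
        (Primrec.const _) ?_)
    refine Primrec.list_flatMap (Primrec.fst.comp Primrec.snd) ?_
    exact D.primrec_morphism.comp (Primrec.snd.comp (Primrec.snd.comp Primrec.fst)) Primrec.snd
  refine (rePred_exists (p := fun (w : List A) (l : List ℕ) => w.map Sum.inl =
    l.foldl (fun u i => applyMorphism (D.morphism i) u) D.seed) h1.computablePred).of_eq fun w => ?_
  exact (D.mem_language_iff _).symm

/-! ### Words for the relators of Hall's group and its quotients -/

/-- A word for the commutator of the elements given by two words. -/
def commWord {k : ℕ} (u v : List (Fin k × Bool)) : List (Fin k × Bool) :=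
  FreeGroup.invRev u ++ (FreeGroup.invRev v ++ (u ++ v))

theorem mk_commWord {k : ℕ} (u v : List (Fin k × Bool)) :
    FreeGroup.mk (commWord u v) = comm (FreeGroup.mk u) (FreeGroup.mk v) := by
  simp [commWord, comm, ← FreeGroup.mul_mk, FreeGroup.inv_mk, mul_assoc]

/-- The word `xⁿ` for a letter `x`. -/
def powWord {A : Type*} (x : A) (n : ℕ) : List A := (List.range n).map fun _ => x

theorem mk_powWord {k : ℕ} (x : Fin k × Bool) (n : ℕ) :
    FreeGroup.mk (powWord x n) = FreeGroup.mk [x] ^ n := by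
  induction n with
  | zero => rfl
  | succ n ih =>
    rw [pow_succ, ← ih, FreeGroup.mul_mk]
    simp [powWord, List.range_succ]

/-- A word for `b_{i - j}`. -/
def conjWord (i j : ℕ) : List (Fin 2 × Bool) :=
  powWord (0, false) i ++ (powWord (0, true) j ++ ((1, true) ::
    (powWord (0, false) j ++ powWord (0, true) i)))

theorem mk_conjWord (i j : ℕ) : FreeGroup.mk (conjWord i j) = conjB (i - j) := by
  have h1 : FreeGroup.mk [((0 : Fin 2), true)] = genA := rfl
  have h2 : FreeGroup.mk [((0 : Fin 2), false)] = genA⁻¹ := rfl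
  have h3 : FreeGroup.mk [((1 : Fin 2), true)] = genB := rfl
  rw [conjWord, ← List.singleton_append]
  simp only [← FreeGroup.mul_mk, mk_powWord, h1, h2, h3, conjB]
  rw [show -((i : ℤ) - j) = -i + j by ring, show (i : ℤ) - j = -j + i by ring, zpow_add, zpow_add]
  simp only [inv_pow, zpow_natCast, zpow_neg, mul_assoc]

/-- A word for `[b, a, …, a]`. -/
def iterWord (n : ℕ) : List (Fin 2 × Bool) :=
  n.rec [(1, true)] fun _ w => commWord w [(0, true)]

theorem mk_iterWord (n : ℕ) : FreeGroup.mk (iterWord n) = iterComm n := by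
  induction n with
  | zero => rfl
  | succ n ih =>
    rw [iterComm, ← ih]
    exact mk_commWord _ _

/-- A word for `f_n`. -/
def fWord (n : ℕ) : List (Fin 2 × Bool) := commWord (iterWord n) [(1, true)]

theorem mk_fWord (n : ℕ) : FreeGroup.mk (fWord n) = fElt n := by
  rw [fWord, mk_commWord, mk_iterWord]; rfl

theorem primrec_invRev (k : ℕ) : Primrec (FreeGroup.invRev (α := Fin k)) :=
  Primrec.list_reverse.comp (Primrec.list_map Primrec.id
    ((Primrec.dom_finite fun x : Fin k × Bool => (x.1, !x.2)).comp Primrec.snd).to₂)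

theorem primrec_commWord (k : ℕ) : Primrec₂ (commWord (k := k)) :=
  Primrec.list_append.comp ((primrec_invRev k).comp Primrec.fst)
    (Primrec.list_append.comp ((primrec_invRev k).comp Primrec.snd)
      (Primrec.list_append.comp Primrec.fst Primrec.snd))

theorem primrec_powWord {A : Type*} [Primcodable A] (x : A) : Primrec (powWord x) :=
  Primrec.list_map Primrec.list_range (Primrec.const x)

theorem primrec_conjWord : Primrec₂ conjWord := by
  refine Primrec.list_append.comp ((primrec_powWord _).comp Primrec.fst)
    (Primrec.list_append.comp ((primrec_powWord _).comp Primrec.snd)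
      (Primrec.list_cons.comp (Primrec.const _)
        (Primrec.list_append.comp ((primrec_powWord _).comp Primrec.snd)
          ((primrec_powWord _).comp Primrec.fst))))

theorem primrec_iterWord : Primrec iterWord :=
  Primrec.nat_rec₁ _ ((primrec_commWord 2).comp Primrec.snd (Primrec.const _))

theorem primrec_fWord : Primrec fWord :=
  (primrec_commWord 2).comp primrec_iterWord (Primrec.const _)

/-! ### The sequence of odd primes -/

theorem primrec_pow : Primrec₂ fun p t : ℕ => p ^ t := by
  have h : Primrec₂ fun p t : ℕ => t.rec (motive := fun _ => ℕ) 1 fun _ r => r * p :=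
    Primrec.nat_rec (Primrec.const 1)
      (Primrec.nat_mul.comp (Primrec.snd.comp Primrec.snd) Primrec.fst).to₂
  refine h.of_eq fun p t => ?_
  induction t with
  | zero => rfl
  | succ t ih => rw [pow_succ, ← ih]

theorem primrecPred_prime : PrimrecPred Nat.Prime := by
  have h : PrimrecPred fun n : ℕ => 2 ≤ n ∧ ∀ m < n, ¬(2 ≤ m ∧ n % m = 0) := by
    refine (Primrec.nat_le.comp (Primrec.const 2) Primrec.id).and
      (primrecPred_forall_lt Primrec.id (PrimrecPred.not ?_))
    exact (Primrec.nat_le.comp (Primrec.const 2) Primrec.snd).and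
      (Primrec.eq.comp (Primrec.nat_mod.comp Primrec.fst Primrec.snd) (Primrec.const 0))
  refine h.of_eq fun n => ?_
  rw [Nat.prime_def_lt']
  simp only [Nat.dvd_iff_mod_eq_zero]
  grind

/-- Counting the primes below p (2 included, hence n + 1) gives a primitive recursive graph for
`oddPrime`. -/
theorem eq_oddPrime_iff (p n : ℕ) :
    p = oddPrime n ↔ p.Prime ∧ ((List.range p).filter (Nat.Prime ·)).length = n + 1 := by
  have hc : ∀ p, ((List.range p).filter (Nat.Prime ·)).length = Nat.count Nat.Prime p := by
    intro p
    induction p with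
    | zero => rfl
    | succ p ih =>
      rw [List.range_succ, List.filter_append, List.length_append, ih, Nat.count_succ]
      by_cases h : p.Prime <;> simp [h]
  rw [hc, oddPrime]
  constructor
  · rintro rfl
    exact ⟨Nat.prime_nth_prime _, Nat.count_nth_of_infinite Nat.infinite_setOfPred_prime _⟩
  · rintro ⟨h1, h2⟩
    rw [← h2, Nat.nth_count h1]

theorem primrecRel_eq_oddPrime : PrimrecRel fun p n : ℕ => p = oddPrime n := by
  have h : PrimrecRel fun p n : ℕ =>
      p.Prime ∧ ((List.range p).filter (Nat.Prime ·)).length = n + 1 :=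
    (primrecPred_prime.comp Primrec.fst).and (Primrec.eq.comp
      (Primrec.list_length.comp ((Primrec.listFilter primrecPred_prime).comp
        (Primrec.list_range.comp Primrec.fst))) (Primrec.succ.comp Primrec.snd))
  exact h.of_eq fun p n => (eq_oddPrime_iff p n).symm

theorem prime_oddPrime (n : ℕ) : (oddPrime n).Prime := Nat.prime_nth_prime _

theorem three_le_oddPrime (n : ℕ) : 3 ≤ oddPrime n := by
  rw [← Nat.nth_prime_one_eq_three]
  exact (Nat.nth_monotone Nat.infinite_setOfPred_prime) (by omega)

theorem oddPrime_injective : Function.Injective oddPrime := fun m n h => by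
  have := Nat.nth_injective Nat.infinite_setOfPred_prime h
  omega

/-! ### `H` is recursively presented -/

theorem normalClosure_eq_ker_lift_of {α : Type*} (rels : Set (FreeGroup α)) :
    Subgroup.normalClosure rels =
      (FreeGroup.lift fun i => (PresentedGroup.of i : PresentedGroup rels)).ker := by
  have : (FreeGroup.lift fun i => (PresentedGroup.of i : PresentedGroup rels)) =
      PresentedGroup.mk rels := by ext; simp; rfl
  rw [this]
  exact (QuotientGroup.ker_mk' _).symm

theorem closure_range_hallMarking (τ : ℕ →. ℕ) :
    Subgroup.closure (Set.range (hallMarking τ)) = ⊤ :=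
  PresentedGroup.closure_range_of _

/-- Each relator word is determined by a numerical witness: two integers written as differences of
naturals, or a pair (n, t) in the decidable graph of τ together with the n-th odd prime, which is
guessed and verified. -/
theorem hallQuotient_mem_presented_RE {τ : ℕ →. ℕ} (hτ : IsHaltingTime τ) :
    GrpCat.of (hallQuotient τ) ∈ presented RE := by
  let P : List (Fin 2 × Bool) → (((ℕ × ℕ) × (ℕ × ℕ)) × ((ℕ × ℕ) × ℕ)) → Prop := fun w q =>
    w = commWord (commWord (conjWord q.1.1.1 q.1.1.2) (conjWord q.1.2.1 q.1.2.2)) [(0, true)] ∨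
    w = commWord (commWord (conjWord q.1.1.1 q.1.1.2) (conjWord q.1.2.1 q.1.2.2)) [(1, true)] ∨
    (q.2.1.2 ∈ τ q.2.1.1 ∧ q.2.2 = oddPrime q.2.1.1 ∧
      w = fWord q.2.2 ++ FreeGroup.invRev (fWord (q.2.2 ^ q.2.1.2)))
  have hP : ComputablePred fun x : List (Fin 2 × Bool) × _ => P x.1 x.2 := by
    have hq : Primrec fun x : List (Fin 2 × Bool) × (((ℕ × ℕ) × (ℕ × ℕ)) × ((ℕ × ℕ) × ℕ)) => x.2 :=
      Primrec.snd
    have hc : Primrec fun x : List (Fin 2 × Bool) × (((ℕ × ℕ) × (ℕ × ℕ)) × ((ℕ × ℕ) × ℕ)) =>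
        commWord (conjWord x.2.1.1.1 x.2.1.1.2) (conjWord x.2.1.2.1 x.2.1.2.2) :=
      (primrec_commWord 2).comp
        (primrec_conjWord.comp (Primrec.fst.comp (Primrec.fst.comp (Primrec.fst.comp hq)))
          (Primrec.snd.comp (Primrec.fst.comp (Primrec.fst.comp hq))))
        (primrec_conjWord.comp (Primrec.fst.comp (Primrec.snd.comp (Primrec.fst.comp hq)))
          (Primrec.snd.comp (Primrec.snd.comp (Primrec.fst.comp hq))))
    have hn := Primrec.fst.comp (Primrec.fst.comp (Primrec.snd.comp hq))
    have ht := Primrec.snd.comp (Primrec.fst.comp (Primrec.snd.comp hq))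
    have hp := Primrec.snd.comp (Primrec.snd.comp hq)
    refine computablePred_or (PrimrecPred.computablePred ?_)
      (computablePred_or (PrimrecPred.computablePred ?_)
        (computablePred_and ?_ (PrimrecPred.computablePred ?_)))
    · exact Primrec.eq.comp Primrec.fst ((primrec_commWord 2).comp hc (Primrec.const _))
    · exact Primrec.eq.comp Primrec.fst ((primrec_commWord 2).comp hc (Primrec.const _))
    · exact computablePred_comp hτ.decidable_graph (Primrec.pair hn ht).to_comp
    · refine (primrecRel_eq_oddPrime.comp hp hn).and (Primrec.eq.comp Primrec.fst ?_)
      exact Primrec.list_append.comp (primrec_fWord.comp hp)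
        ((primrec_invRev 2).comp (primrec_fWord.comp (primrec_pow.comp hp ht)))
  refine ⟨2, hallMarking τ, {w | ∃ q, P w q}, rePred_exists hP, closure_range_hallMarking τ, ?_⟩
  refine Eq.trans ?_ (normalClosure_eq_ker_lift_of _)
  congr 1
  have hz : ∀ i : ℤ, ∃ u v : ℕ, i = u - v := fun i => ⟨i.toNat, (-i).toNat, by omega⟩
  ext x
  constructor
  · rintro ⟨w, ⟨q, h | h | ⟨h1, h2, h3⟩⟩, rfl⟩
    · left
      exact ⟨_, _, Or.inl (by rw [h, mk_commWord, mk_commWord, mk_conjWord, mk_conjWord]; rfl)⟩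
    · left
      exact ⟨_, _, Or.inr (by rw [h, mk_commWord, mk_commWord, mk_conjWord, mk_conjWord]; rfl)⟩
    · right
      exact ⟨_, _, h1, by rw [h3, ← FreeGroup.mul_mk, ← FreeGroup.inv_mk, mk_fWord, mk_fWord, h2]⟩
  · rintro (⟨i, j, h⟩ | ⟨n, t, h1, h2⟩)
    · obtain ⟨i, i', rfl⟩ := hz i
      obtain ⟨j, j', rfl⟩ := hz j
      rcases h with rfl | rfl
      · refine ⟨_, ⟨(((i, i'), (j, j')), ((0, 0), 0)), Or.inl rfl⟩, ?_⟩
        rw [mk_commWord, mk_commWord, mk_conjWord, mk_conjWord]; rfl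
      · refine ⟨_, ⟨(((i, i'), (j, j')), ((0, 0), 0)), Or.inr (Or.inl rfl)⟩, ?_⟩
        rw [mk_commWord, mk_commWord, mk_conjWord, mk_conjWord]; rfl
    · refine ⟨_, ⟨(((0, 0), (0, 0)), ((n, t), oddPrime n)), Or.inr (Or.inr ⟨h1, rfl, rfl⟩)⟩, ?_⟩
      rw [h2, ← FreeGroup.mul_mk, ← FreeGroup.inv_mk, mk_fWord, mk_fWord]

/-! ### A finite nilpotent quotient detecting `f_p` -/

/-- An extension of a Heisenberg group over `R`, with centre `S`, by the powers of a unit `x`. -/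
@[ext]
structure HeisenbergExt {R S : Type} [CommRing R] [AddCommGroup S] (θ : R →+ S) (x : Rˣ) where
  u : R
  v : R
  s : S
  g : Subgroup.zpowers x

namespace HeisenbergExt

variable {R S : Type} [CommRing R] [AddCommGroup S] {θ : R →+ S} {x : Rˣ}

/-- A power g of the unit sends (u, v) to (gu, g⁻¹v). This preserves the product uv, hence the
cocycle, which is why the multiplication is associative. As θ is only additive, the centre can be
cut down by any additive subgroup of R, not just by ideals. -/
instance : Mul (HeisenbergExt θ x) :=
  ⟨fun A B => ⟨A.u + (A.g : Rˣ) * B.u, A.v + ((A.g : Rˣ)⁻¹ : Rˣ) * B.v,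
    A.s + B.s + θ (A.u * (((A.g : Rˣ)⁻¹ : Rˣ) * B.v)), A.g * B.g⟩⟩

instance : One (HeisenbergExt θ x) := ⟨⟨0, 0, 0, 1⟩⟩

instance : Inv (HeisenbergExt θ x) :=
  ⟨fun A => ⟨-(((A.g : Rˣ)⁻¹ : Rˣ) * A.u), -((A.g : Rˣ) * A.v), -A.s + θ (A.u * A.v), A.g⁻¹⟩⟩

@[simp] theorem mul_u (A B : HeisenbergExt θ x) : (A * B).u = A.u + (A.g : Rˣ) * B.u := rfl
@[simp] theorem mul_v (A B : HeisenbergExt θ x) :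
    (A * B).v = A.v + ((A.g : Rˣ)⁻¹ : Rˣ) * B.v := rfl
@[simp] theorem mul_s (A B : HeisenbergExt θ x) :
    (A * B).s = A.s + B.s + θ (A.u * (((A.g : Rˣ)⁻¹ : Rˣ) * B.v)) := rfl
@[simp] theorem mul_g (A B : HeisenbergExt θ x) : (A * B).g = A.g * B.g := rfl
@[simp] theorem one_u : (1 : HeisenbergExt θ x).u = 0 := rfl
@[simp] theorem one_v : (1 : HeisenbergExt θ x).v = 0 := rfl
@[simp] theorem one_s : (1 : HeisenbergExt θ x).s = 0 := rfl
@[simp] theorem one_g : (1 : HeisenbergExt θ x).g = 1 := rfl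
@[simp] theorem inv_u (A : HeisenbergExt θ x) : A⁻¹.u = -(((A.g : Rˣ)⁻¹ : Rˣ) * A.u) := rfl
@[simp] theorem inv_v (A : HeisenbergExt θ x) : A⁻¹.v = -((A.g : Rˣ) * A.v) := rfl
@[simp] theorem inv_s (A : HeisenbergExt θ x) : A⁻¹.s = -A.s + θ (A.u * A.v) := rfl
@[simp] theorem inv_g (A : HeisenbergExt θ x) : A⁻¹.g = A.g⁻¹ := rfl

instance : Group (HeisenbergExt θ x) := by
  refine Group.ofLeftAxioms ?_ ?_ ?_
  · intro A B C
    have h := (A.g : Rˣ).mul_inv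
    ext
    · simp; ring
    · simp; ring
    · have : (A.u + (A.g : Rˣ) * B.u) * (((B.g : Rˣ)⁻¹ : Rˣ) * ((A.g : Rˣ)⁻¹ : Rˣ) * C.v) =
          B.u * (((B.g : Rˣ)⁻¹ : Rˣ) * C.v) +
            A.u * (((A.g : Rˣ)⁻¹ : Rˣ) * (((B.g : Rˣ)⁻¹ : Rˣ) * C.v)) := by
        linear_combination B.u * ((B.g : Rˣ)⁻¹ : Rˣ) * C.v * h
      simp only [mul_s, mul_u, mul_g, mul_v, Subgroup.coe_mul, mul_inv_rev, Units.val_mul, this,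
        mul_add, map_add]
      abel
    · simp [mul_assoc]
  · intro A
    ext <;> simp
  · intro A
    have h := (A.g : Rˣ).inv_mul
    ext
    · simp
    · simp
    · have : -(((A.g : Rˣ)⁻¹ : Rˣ) * A.u) * ((A.g : Rˣ) * A.v) = -(A.u * A.v) := by
        linear_combination -(A.u * A.v) * h
      simp [this]
    · simp

/-- The elements of the Heisenberg subgroup. -/
def hz (u v : R) (s : S) : HeisenbergExt θ x := ⟨u, v, s, 1⟩

/-- The complement of the Heisenberg subgroup. -/
def tor : Subgroup.zpowers x →* HeisenbergExt θ x where
  toFun g := ⟨0, 0, 0, g⟩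
  map_one' := rfl
  map_mul' g h := by ext <;> simp

/-- The image of the generator `a`. -/
def eltA : HeisenbergExt θ x := tor ⟨x, Subgroup.mem_zpowers x⟩⁻¹

/-- The image of the generator `b`. -/
def eltB : HeisenbergExt θ x := hz 1 1 0

theorem hz_zero : (hz 0 0 0 : HeisenbergExt θ x) = 1 := rfl

theorem hz_mul (u v u' v' : R) (s s' : S) :
    (hz u v s * hz u' v' s' : HeisenbergExt θ x) = hz (u + u') (v + v') (s + s' + θ (u * v')) := by
  ext <;> simp [hz]

theorem hz_inv (u v : R) (s : S) :
    (hz u v s : HeisenbergExt θ x)⁻¹ = hz (-u) (-v) (-s + θ (u * v)) := by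
  ext <;> simp [hz]

theorem tor_mul_hz_mul (g : Subgroup.zpowers x) (u v : R) (s : S) :
    (tor g * hz u v s * tor g⁻¹ : HeisenbergExt θ x) =
      hz ((g : Rˣ) * u) (((g : Rˣ)⁻¹ : Rˣ) * v) s := by
  ext <;> simp [hz, tor]

theorem comm_hz_hz (u v u' v' : R) (s s' : S) :
    comm (hz u v s : HeisenbergExt θ x) (hz u' v' s') = hz 0 0 (θ (u * v' - u' * v)) := by
  rw [comm, hz_inv, hz_inv, hz_mul, hz_mul, hz_mul]
  congr 1
  · ring
  · ring
  · simp only [map_sub, map_add, map_neg, mul_neg, neg_mul, add_mul, neg_neg]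
    abel

theorem comm_hz_zero (s : S) (A : HeisenbergExt θ x) : comm (hz 0 0 s) A = 1 := by
  have : A⁻¹ * hz 0 0 s = hz 0 0 s * A⁻¹ := by
    ext <;> simp [hz, add_comm]
  rw [comm, mul_assoc (hz 0 0 s)⁻¹, this]
  group

/-- Since `eltA` is the inverse of the torus element of x, the conjugation h ↦ a⁻¹ha multiplies u by
x and v by x⁻¹. Iterated commutators with a therefore produce powers of x - 1 and x⁻¹ - 1. -/
theorem comm_hz_eltA (u v : R) (s : S) :
    comm (hz u v s : HeisenbergExt θ x) eltA = hz (((x : R) - 1) * u)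
      (((x⁻¹ : Rˣ) - 1 : R) * v) (θ (u * v * (1 - (x⁻¹ : Rˣ)))) := by
  have h1 : comm (hz u v s : HeisenbergExt θ x) eltA =
      (hz u v s)⁻¹ * (tor ⟨x, Subgroup.mem_zpowers x⟩ * hz u v s *
        tor ⟨x, Subgroup.mem_zpowers x⟩⁻¹) := by
    simp [comm, eltA, mul_assoc]
  rw [h1, tor_mul_hz_mul, hz_inv, hz_mul]
  congr 1
  · simp; ring
  · simp
    ring
  · have : u * v * (1 - (x⁻¹ : Rˣ)) = u * v + -u * ((x⁻¹ : Rˣ) * v) := by ring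
    rw [this, map_add]
    simp

/-- The homomorphism from the free group sending `a` and `b` to `eltA` and `eltB`. -/
def ofFree (θ : R →+ S) (x : Rˣ) : FreeGroup (Fin 2) →* HeisenbergExt θ x :=
  FreeGroup.lift ![eltA, eltB]

theorem map_comm {K L : Type*} [Group K] [Group L] (f : K →* L) (a b : K) :
    f (comm a b) = comm (f a) (f b) := by simp [comm]

theorem ofFree_genA : ofFree θ x genA = eltA := by simp [ofFree, genA]

theorem ofFree_genB : ofFree θ x genB = eltB := by simp [ofFree, genB]

theorem ofFree_conjB (i : ℤ) :
    ofFree θ x (conjB i) = hz ((x ^ i : Rˣ) : R) ((x ^ (-i) : Rˣ) : R) 0 := by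
  have h := tor_mul_hz_mul (θ := θ) (⟨x, Subgroup.mem_zpowers x⟩ ^ i) 1 1 0
  simp only [conjB, map_mul, map_zpow, ofFree_genA, ofFree_genB, eltA, eltB]
  simp only [map_inv, map_zpow, inv_zpow, zpow_neg, inv_inv] at h ⊢
  rw [h]
  simp

theorem ofFree_hallRelators {r : FreeGroup (Fin 2)} (hr : r ∈ hallRelators) :
    ofFree θ x r = 1 := by
  obtain ⟨i, j, rfl | rfl⟩ := hr <;>
    rw [map_comm, map_comm, ofFree_conjB, ofFree_conjB, comm_hz_hz, comm_hz_zero]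

theorem ofFree_iterComm_succ (n : ℕ) :
    ofFree θ x (iterComm (n + 1)) = hz (((x : R) - 1) ^ (n + 1)) (((x⁻¹ : Rˣ) - 1 : R) ^ (n + 1))
      (θ (((x : R) - 1) ^ n * ((x⁻¹ : Rˣ) - 1 : R) ^ n * (1 - (x⁻¹ : Rˣ)))) := by
  induction n with
  | zero => rw [iterComm, map_comm, iterComm, ofFree_genA, ofFree_genB, eltB, comm_hz_eltA]; simp
  | succ n ih =>
    rw [iterComm, map_comm, ih, ofFree_genA, comm_hz_eltA, ← pow_succ', ← pow_succ']

theorem ofFree_fElt (n : ℕ) :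
    ofFree θ x (fElt n) = hz 0 0 (θ (((x : R) - 1) ^ n - ((x⁻¹ : Rˣ) - 1 : R) ^ n)) := by
  rw [fElt, map_comm, ofFree_genB, eltB]
  rcases n with _ | n
  · rw [iterComm, ofFree_genB, eltB, comm_hz_hz]; simp
  · rw [ofFree_iterComm_succ, comm_hz_hz]; simp

/-- The underlying set of `HeisenbergExt` as a product. -/
def equivProd : HeisenbergExt θ x ≃ R × R × S × Subgroup.zpowers x where
  toFun A := (A.u, A.v, A.s, A.g)
  invFun A := ⟨A.1, A.2.1, A.2.2.1, A.2.2.2⟩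

theorem finite [Finite R] [Finite S] : Finite (HeisenbergExt θ x) :=
  Finite.of_equiv _ equivProd.symm

theorem isNilpotent {p i j k : ℕ} [Fact p.Prime] (hR : Nat.card R = p ^ i) (hS : Nat.card S = p ^ j)
    (hx : x ^ p ^ k = 1) : Group.IsNilpotent (HeisenbergExt θ x) := by
  have hp : 0 < p := (Fact.out : p.Prime).pos
  have : Finite R := Nat.finite_of_card_ne_zero (by rw [hR]; positivity)
  have : Finite S := Nat.finite_of_card_ne_zero (by rw [hS]; positivity)
  have := finite (θ := θ) (x := x)
  obtain ⟨l, -, hl⟩ := (Nat.dvd_prime_pow Fact.out).1 (orderOf_dvd_of_pow_eq_one hx)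
  have hc : Nat.card (HeisenbergExt θ x) = p ^ (i + (i + (j + l))) := by
    rw [Nat.card_congr equivProd, Nat.card_prod, Nat.card_prod, Nat.card_prod, hR, hS,
      Nat.card_zpowers, hl]
    ring
  exact (IsPGroup.of_card hc).isNilpotent

end HeisenbergExt

/-! ### Independence in truncated polynomial rings, and survival of f_p -/

theorem mul_pow_eq_of_pow_succ_eq_zero {R : Type*} [CommRing R] {y x' : R} {p : ℕ} (hy : y ^ (p + 1) = 0)
    (hx' : x' * (1 + y) = 1) (n : ℕ) : y ^ p * x' ^ n = y ^ p := by
  induction n with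
  | zero => simp
  | succ n ih =>
    have : y ^ p * x' = y ^ p := by linear_combination y ^ p * hx' - x' * hy
    rw [pow_succ', ← mul_assoc, this, ih]

/-- The elements `(x - 1)ⁿ - (x⁻¹ - 1)ⁿ`, for odd `n`, in a ring of truncated polynomials in
`y = x - 1`, are independent: the `p`-th is not in the span of the others. -/
theorem sub_notMem_closure {R : Type*} [CommRing R] [Algebra (ZMod 3) R] {y x' : R} {p : ℕ}
    (hp : Odd p) (hy : y ^ (p + 1) = 0) (hy' : y ^ p ≠ 0) (hx' : x' * (1 + y) = 1) :
    y ^ p - (x' - 1) ^ p ∉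
      AddSubgroup.closure {r | ∃ n, Odd n ∧ n ≠ p ∧ r = y ^ n - (x' - 1) ^ n} := by
  have hz : ∀ n, p < n → y ^ n = 0 := fun n hn => pow_eq_zero_of_le hn hy
  -- For odd n the sign of x' - 1 = -x'y turns the difference into a sum with lowest term 2yⁿ, and 2
  -- is invertible modulo 3. Distinct n thus give distinct orders of vanishing.
  have hg : ∀ n, Odd n → y ^ n - (x' - 1) ^ n = y ^ n * (1 + x' ^ n) := by
    intro n hn
    have : x' - 1 = -(x' * y) := by linear_combination hx'
    rw [this, hn.neg_pow, mul_pow]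
    ring
  have h2 : ∀ n, y ^ p * (1 + x' ^ n) = (2 : ZMod 3) • y ^ p := by
    intro n
    rw [mul_add, mul_pow_eq_of_pow_succ_eq_zero hy hx', two_smul, mul_one]
  have htwo : (2 : ZMod 3) ≠ 0 := by decide
  intro hmem
  have key : ∀ w ∈ AddSubgroup.closure {r | ∃ n, Odd n ∧ n ≠ p ∧ r = y ^ n - (x' - 1) ^ n},
      ∃ c : ℕ → ZMod 3, w = ∑ n ∈ Finset.range p, c n • (y ^ n * (1 + x' ^ n)) := by
    intro w hw
    induction hw using AddSubgroup.closure_induction with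
    | mem w hw =>
      obtain ⟨n, hn, hnp, rfl⟩ := hw
      rw [hg n hn]
      rcases lt_or_gt_of_ne hnp with h | h
      · refine ⟨Pi.single n 1, ?_⟩
        rw [Finset.sum_eq_single n]
        · simp
        · intro m _ hm
          simp [Pi.single_eq_of_ne hm]
        · simp [h]
      · exact ⟨0, by simp [hz n h]⟩
    | zero => exact ⟨0, by simp⟩
    | add a b _ _ ha hb =>
      obtain ⟨c, rfl⟩ := ha
      obtain ⟨d, rfl⟩ := hb
      exact ⟨c + d, by simp [add_smul, Finset.sum_add_distrib]⟩
    | neg a _ ha =>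
      obtain ⟨c, rfl⟩ := ha
      exact ⟨-c, by simp⟩
  obtain ⟨c, hc⟩ := key _ hmem
  rw [hg p hp, h2] at hc
  -- Multiplying by y^(p - n) kills the left side and all terms of index above n; those below n
  -- vanish by induction. What remains is 2 c_n y^p = 0.
  have hc0 : ∀ n < p, c n = 0 := by
    intro n
    induction n using Nat.strong_induction_on with
    | _ n ih =>
      intro hn
      have h3 := congrArg (fun r => y ^ (p - n) * r) hc
      simp only [Finset.mul_sum] at h3
      rw [Finset.sum_eq_single n] at h3
      · rw [mul_smul_comm, ← pow_add, hz _ (by omega), smul_zero, mul_smul_comm, ← mul_assoc,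
          ← pow_add, Nat.sub_add_cancel hn.le, h2, smul_smul] at h3
        have := (smul_eq_zero.1 h3.symm).resolve_right hy'
        exact (mul_eq_zero.1 this).resolve_right htwo
      · intro m hm hmn
        rcases lt_or_gt_of_ne hmn with h | h
        · rw [ih m h (by omega), zero_smul, mul_zero]
        · rw [mul_smul_comm, ← mul_assoc, ← pow_add, hz _ (by omega), zero_mul, smul_zero]
      · simp [hn]
  rw [Finset.sum_eq_zero fun n hn => by rw [hc0 n (Finset.mem_range.1 hn), zero_smul]] at hc
  exact (smul_ne_zero htwo hy') hc

open Polynomial in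
theorem exists_finite_truncated_ring (p : ℕ) :
    ∃ (R : Type) (_ : CommRing R) (_ : Algebra (ZMod 3) R) (_ : Finite R) (y : R),
      y ^ (p + 1) = 0 ∧ y ^ p ≠ 0 := by
  have hm : (X ^ (p + 1) : (ZMod 3)[X]).Monic := monic_X_pow _
  have := hm.finite_adjoinRoot
  refine ⟨AdjoinRoot (X ^ (p + 1) : (ZMod 3)[X]), inferInstance, inferInstance,
    Module.finite_of_finite (ZMod 3), AdjoinRoot.root _, ?_, ?_⟩
  · rw [← AdjoinRoot.mk_X, ← map_pow, AdjoinRoot.mk_self]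
  · rw [← AdjoinRoot.mk_X, ← map_pow, Ne, AdjoinRoot.mk_eq_zero]
    intro h
    have := (pow_dvd_pow_iff (a := (X : (ZMod 3)[X])) X_ne_zero not_isUnit_X).1 h
    omega

/-- If the `n`-th machine does not halt, or halts after one step, then `f_p` survives in some finite
nilpotent quotient, for the `n`-th odd prime `p`. -/
theorem exists_nilpotent_quotient {τ : ℕ →. ℕ} {n : ℕ}
    (hn : ∀ t ∈ τ n, t = 1) :
    ∃ (Q : Type) (_ : Group Q) (_ : Finite Q) (_ : Group.IsNilpotent Q) (φ : hallQuotient τ →* Q),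
      φ (PresentedGroup.mk _ (fElt (oddPrime n))) ≠ 1 ∧
      φ (PresentedGroup.mk _ (iterComm (oddPrime n ^ 2))) = 1 := by
  obtain ⟨R, _, _, _, y, hy, hy'⟩ := exists_finite_truncated_ring (oddPrime n)
  have h3 := three_le_oddPrime n
  have hprime := prime_oddPrime n
  set p := oddPrime n
  have hodd : ∀ m, Odd (oddPrime m) := fun m =>
    (prime_oddPrime m).odd_of_ne_two (by have := three_le_oddPrime m; omega)
  have : Nontrivial R := ⟨⟨_, _, hy'⟩⟩
  have : CharP R 3 := charP_of_injective_algebraMap (algebraMap (ZMod 3) R).injective 3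
  obtain ⟨x, hx⟩ : IsUnit (1 + y) := IsNilpotent.isUnit_one_add ⟨_, hy⟩
  have hxy : (x : R) - 1 = y := by rw [hx]; ring
  have hx' : ((x⁻¹ : Rˣ) : R) * (1 + y) = 1 := by rw [← hx]; exact x.inv_mul
  have hx'n : ((x⁻¹ : Rˣ) : R) - 1 = -((x⁻¹ : Rˣ) * y) := by linear_combination hx'
  -- Dividing the centre by W kills every f_m with m odd and different from p, hence both sides of
  -- all halting relators of the other machines.
  let W := AddSubgroup.closure {r : R | ∃ n, Odd n ∧ n ≠ p ∧ r = y ^ n - ((x⁻¹ : Rˣ) - 1 : R) ^ n}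
  let θ := QuotientAddGroup.mk' W
  have hW : ∀ m, Odd m → m ≠ p → θ (y ^ m - ((x⁻¹ : Rˣ) - 1 : R) ^ m) = 0 := fun m hm hmp =>
    (QuotientAddGroup.eq_zero_iff _).2 (AddSubgroup.subset_closure ⟨m, hm, hmp, rfl⟩)
  have hf : ∀ m, HeisenbergExt.ofFree θ x (fElt m) =
      HeisenbergExt.hz 0 0 (θ (y ^ m - ((x⁻¹ : Rˣ) - 1 : R) ^ m)) := by
    intro m
    rw [HeisenbergExt.ofFree_fElt, hxy]
  have hrel : ∀ r ∈ hallRelators ∪ haltingRelators τ, HeisenbergExt.ofFree θ x r = 1 := by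
    rintro r (hr | ⟨m, t, ht, rfl⟩)
    · exact HeisenbergExt.ofFree_hallRelators hr
    · rw [map_mul, map_inv, mul_inv_eq_one]
      by_cases hmn : m = n
      · rw [hmn] at ht
        rw [hn t ht, pow_one]
      · have hmp : oddPrime m ≠ p := fun h => hmn (oddPrime_injective h)
        rw [hf, hf, hW _ (hodd m) hmp, hW _ (hodd m).pow]
        intro h
        have h1 : (oddPrime m ^ t).Prime := h ▸ hprime
        rw [Nat.Prime.eq_one_of_pow h1, pow_one] at h
        exact hmp h
  have hnil : Group.IsNilpotent (HeisenbergExt θ x) := by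
    have : Fact (Nat.Prime 3) := ⟨Nat.prime_three⟩
    have hR : Nat.card R = 3 ^ Module.finrank (ZMod 3) R := by
      rw [Module.natCard_eq_pow_finrank (K := ZMod 3), Nat.card_zmod]
    obtain ⟨j, -, hj⟩ := (Nat.dvd_prime_pow Nat.prime_three).1
      (hR ▸ AddSubgroup.card_quotient_dvd_card W)
    -- In characteristic 3, (1 + y)^(3^(p+1)) = 1 + y^(3^(p+1)), and the last power vanishes as
    -- 3^(p+1) > p + 1.
    refine HeisenbergExt.isNilpotent hR hj (k := p + 1) ?_
    ext
    rw [Units.val_pow_eq_pow_val, hx, add_pow_char_pow, one_pow,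
      pow_eq_zero_of_le (Nat.lt_pow_self (by norm_num)).le hy, add_zero, Units.val_one]
  refine ⟨HeisenbergExt θ x, inferInstance, HeisenbergExt.finite, hnil,
    PresentedGroup.toGroup (f := ![HeisenbergExt.eltA, HeisenbergExt.eltB]) hrel, ?_, ?_⟩
  · intro h
    have h1 : HeisenbergExt.ofFree θ x (fElt p) = 1 := h
    rw [hf, ← HeisenbergExt.hz_zero] at h1
    have h2 := congrArg HeisenbergExt.s h1
    exact sub_notMem_closure (hodd n) hy hy' hx' ((QuotientAddGroup.eq_zero_iff _).1 h2)
  · change HeisenbergExt.ofFree θ x (iterComm (p ^ 2)) = 1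
    obtain ⟨m, hm⟩ : ∃ m, p ^ 2 = m + 1 := Nat.exists_eq_succ_of_ne_zero (by positivity)
    have hm' : p + 1 ≤ m := by nlinarith
    rw [hm, HeisenbergExt.ofFree_iterComm_succ, hxy, hx'n, neg_pow, neg_pow _ m, mul_pow, mul_pow,
      pow_eq_zero_of_le hm' hy, pow_eq_zero_of_le (hm'.trans m.le_succ) hy]
    simp [HeisenbergExt.hz_zero]

/-! ### Tables for actions of words on finite sets -/

section Tables

variable {B : Type} [Primcodable B]

/-- The action of a letter on `{0, …, M}` read off from a list of tables. -/
def act (M : ℕ) (T : List (List ℕ)) (b : B) (i : ℕ) : ℕ :=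
  -- The defaults and the reduction modulo M + 1 make every list of lists define self-maps of {0, …,
  -- M}, so a search over tables needs no well-formedness condition.
  ((T.getD (Encodable.encode b) []).getD i 0) % (M + 1)

/-- The action of a word on `{0, …, M}` read off from a list of tables. -/
def actWord (M : ℕ) (T : List (List ℕ)) (w : List B) (i : ℕ) : ℕ :=
  w.foldr (fun b i => act M T b i) i

/-- The self-map of `Fin (M + 1)` by which a letter acts. -/
def den (M : ℕ) (T : List (List ℕ)) (b : B) : Function.End (Fin (M + 1)) :=
  fun i => ⟨act M T b i, Nat.mod_lt _ M.succ_pos⟩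

theorem actWord_eq (M : ℕ) (T : List (List ℕ)) (w : List B) (i : Fin (M + 1)) :
    actWord M T w i = ((w.map (den M T)).prod i : Fin (M + 1)) := by
  induction w with
  | nil => rfl
  | cons b w ih =>
    have : actWord M T (b :: w) i = act M T b (actWord M T w i) := rfl
    rw [this, ih]
    rfl

theorem actWord_eq_of_lt (M : ℕ) (T : List (List ℕ)) (w : List B) {i : ℕ} (hi : i < M + 1) :
    actWord M T w i = ((w.map (den M T)).prod ⟨i, hi⟩ : Fin (M + 1)) :=
  actWord_eq M T w ⟨i, hi⟩

theorem exists_den_eq [Finite B] (M : ℕ) (α : B → Function.End (Fin (M + 1))) :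
    ∃ T, den M T = α := by
  have := Fintype.ofFinite B
  let K := Finset.univ.sup (fun b : B => Encodable.encode b) + 1
  refine ⟨(List.range K).map fun n => ((Encodable.decode (α := B) n).map fun b =>
    List.ofFn fun i => (α b i : ℕ)).getD [], ?_⟩
  funext b i
  have hb : Encodable.encode b < K :=
    Nat.lt_succ_of_le (Finset.le_sup (f := fun b : B => Encodable.encode b) (Finset.mem_univ b))
  ext
  have : (α b i : ℕ) % (M + 1) = α b i := Nat.mod_eq_of_lt (α b i).2
  simp [den, act, List.getD_eq_getElem?_getD, hb, this, Nat.le_of_lt_succ i.2, -List.ofFn_succ]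

/-- The word acts trivially on `{0, …, M}`. -/
def ActsTrivially (M : ℕ) (T : List (List ℕ)) (w : List B) : Prop :=
  ∀ i < M + 1, actWord M T w i = i

theorem actsTrivially_iff {M : ℕ} {T : List (List ℕ)} {w : List B} :
    ActsTrivially M T w ↔ (w.map (den M T)).prod = 1 := by
  constructor
  · intro h
    funext i
    ext
    rw [← actWord_eq, h i i.2]
    rfl
  · intro h i hi
    rw [actWord_eq_of_lt M T w hi, h]
    rfl

variable {σ : Type*} [Primcodable σ] {M : σ → ℕ} {T : σ → List (List ℕ)}

theorem primrec_act {b : σ → B} {i : σ → ℕ} (hM : Primrec M) (hT : Primrec T) (hb : Primrec b)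
    (hi : Primrec i) : Primrec fun s => act (M s) (T s) (b s) (i s) :=
  Primrec.nat_mod.comp ((Primrec.list_getD 0).comp
    ((Primrec.list_getD []).comp hT (Primrec.encode.comp hb)) hi) (Primrec.succ.comp hM)

theorem primrec_actWord {w : σ → List B} {i : σ → ℕ} (hM : Primrec M) (hT : Primrec T)
    (hw : Primrec w) (hi : Primrec i) : Primrec fun s => actWord (M s) (T s) (w s) (i s) :=
  Primrec.list_foldr (h := fun s x => act (M s) (T s) x.1 x.2) hw hi
    (primrec_act (hM.comp Primrec.fst) (hT.comp Primrec.fst) (Primrec.fst.comp Primrec.snd)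
      (Primrec.snd.comp Primrec.snd)).to₂

theorem primrecPred_actsTrivially {w : σ → List B} (hM : Primrec M) (hT : Primrec T)
    (hw : Primrec w) : PrimrecPred fun s => ActsTrivially (M s) (T s) (w s) :=
  primrecPred_forall_lt (Primrec.succ.comp hM) (Primrec.eq.comp
    (primrec_actWord (hM.comp Primrec.fst) (hT.comp Primrec.fst) (hw.comp Primrec.fst) Primrec.snd)
    Primrec.snd)

end Tables

/-- The tables describe the permutation representation `ψ` of a free group. -/
def Represents {k M : ℕ} (T : List (List ℕ)) (ψ : FreeGroup (Fin k) →* Equiv.Perm (Fin (M + 1))) :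
    Prop :=
  ∀ w : List (Fin k × Bool), (w.map (den M T)).prod = (ψ (FreeGroup.mk w) : Fin (M + 1) → Fin (M + 1))

theorem Represents.actsTrivially_iff {k M : ℕ} {T : List (List ℕ)}
    {ψ : FreeGroup (Fin k) →* Equiv.Perm (Fin (M + 1))} (h : Represents T ψ)
    (w : List (Fin k × Bool)) : ActsTrivially M T w ↔ FreeGroup.mk w ∈ ψ.ker := by
  rw [LangPres.actsTrivially_iff, h w, MonoidHom.mem_ker]
  exact ⟨fun h => Equiv.coe_fn_injective h, fun h => by rw [h]; rfl⟩

theorem represents_of_letter {k M : ℕ} {T : List (List ℕ)}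
    {ψ : FreeGroup (Fin k) →* Equiv.Perm (Fin (M + 1))}
    (h : ∀ x : Fin k × Bool, den M T x = (ψ (FreeGroup.mk [x]) : Fin (M + 1) → Fin (M + 1))) :
    Represents T ψ := by
  intro w
  induction w with
  | nil => rw [FreeGroup.one_eq_mk.symm, map_one]; rfl
  | cons x w ih =>
    rw [List.map_cons, List.prod_cons, ih, h, ← List.singleton_append (l := w), ← FreeGroup.mul_mk, map_mul]
    rfl

theorem exists_represents {k M : ℕ} (ψ : FreeGroup (Fin k) →* Equiv.Perm (Fin (M + 1))) :
    ∃ T, Represents T ψ := by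
  obtain ⟨T, hT⟩ := exists_den_eq M fun x : Fin k × Bool =>
    (ψ (FreeGroup.mk [x]) : Fin (M + 1) → Fin (M + 1))
  exact ⟨T, represents_of_letter fun x => congrFun hT x⟩

/-- A free group imposes no condition beyond each letter and its formal inverse acting by mutually
inverse maps, which is a finite check. -/
theorem exists_represented {k M : ℕ} {T : List (List ℕ)}
    (h : ∀ x : Fin k × Bool, ActsTrivially M T [x, (x.1, !x.2)]) :
    ∃ ψ : FreeGroup (Fin k) →* Equiv.Perm (Fin (M + 1)), Represents T ψ := by
  have h' : ∀ (x : Fin k × Bool) i, den M T x (den M T (x.1, !x.2) i) = i := fun x i => by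
    have := actsTrivially_iff.1 (h x)
    simp only [List.map_cons, List.map_nil, List.prod_cons, List.prod_nil, mul_one] at this
    exact congrFun this i
  refine ⟨FreeGroup.lift fun i => ⟨den M T (i, true), den M T (i, false),
    fun j => h' (i, false) j, fun j => h' (i, true) j⟩, represents_of_letter ?_⟩
  rintro ⟨i, _ | _⟩
  · simp [FreeGroup.lift_mk]; rfl
  · simp [FreeGroup.lift_mk]; rfl

/-! ### From certificates to the halting problem -/

theorem mk_flatMap_eq_lift {j k : ℕ} (g : Fin j × Bool → List (Fin k × Bool))
    (hg : ∀ i, FreeGroup.mk (g (i, false)) = (FreeGroup.mk (g (i, true)))⁻¹)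
    (w : List (Fin j × Bool)) : FreeGroup.mk (w.flatMap g) =
      FreeGroup.lift (fun i => FreeGroup.mk (g (i, true))) (FreeGroup.mk w) := by
  induction w with
  | nil => rw [FreeGroup.one_eq_mk.symm, map_one]; rfl
  | cons x w ih =>
    rw [List.flatMap_cons, ← FreeGroup.mul_mk, ih, ← List.singleton_append (l := w),
      ← FreeGroup.mul_mk, map_mul]
    congr 1
    rcases x with ⟨i, _ | _⟩
    · simp [hg, FreeGroup.lift_mk]
    · simp [FreeGroup.lift_mk]

/-- The letters can be rewritten as words in any generating family, compatibly with evaluation. -/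
theorem exists_words {H : Type*} [Group H] {j k : ℕ} {s : Fin k → H}
    (hs : Subgroup.closure (Set.range s) = ⊤) (m : Fin j → H) :
    ∃ g : Fin j × Bool → List (Fin k × Bool), ∀ w : List (Fin j × Bool),
      FreeGroup.lift s (FreeGroup.mk (w.flatMap g)) = FreeGroup.lift m (FreeGroup.mk w) := by
  have hsurj : ∀ i, ∃ l : List (Fin k × Bool), FreeGroup.lift s (FreeGroup.mk l) = m i := by
    intro i
    have : m i ∈ (FreeGroup.lift s).range := by
      rw [FreeGroup.range_lift_eq_closure, hs]; trivial
    obtain ⟨x, hx⟩ := this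
    exact ⟨x.toWord, by rw [FreeGroup.mk_toWord, hx]⟩
  choose l hl using hsurj
  refine ⟨fun x => if x.2 then l x.1 else FreeGroup.invRev (l x.1), fun w => ?_⟩
  rw [mk_flatMap_eq_lift _ (fun i => by simp [FreeGroup.inv_mk])]
  have : (FreeGroup.lift s).comp (FreeGroup.lift fun i => FreeGroup.mk (l i)) =
      FreeGroup.lift m := by ext; simp [hl]
  simpa using DFunLike.congr_fun this (FreeGroup.mk w)

theorem iterComm_add_mem_ker {K : Type*} [Group K] (f : FreeGroup (Fin 2) →* K) {n : ℕ}
    (h : f (iterComm n) = 1) (m : ℕ) : f (iterComm (n + m)) = 1 := by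
  induction m with
  | zero => exact h
  | succ m ih => rw [← add_assoc, iterComm, HeisenbergExt.map_comm, ih]; simp [comm]

/-- Let `Kill x M T` be a decidable relation such that its instances certify that the permutation
representation given by the tables `T` factors through `H`, and such that every representation
through a finite nilpotent quotient of `H` is certified. Then halting is decidable. -/
theorem false_of_certificates {τ : ℕ →. ℕ} (hτ : IsHaltingTime τ) {k : ℕ}
    {s : Fin k → hallQuotient τ} (hs : Subgroup.closure (Set.range s) = ⊤)
    {X : Type*} [Primcodable X] (Kill : X → ℕ → List (List ℕ) → Prop)
    (hKill : ComputablePred fun q : X × (ℕ × List (List ℕ)) => Kill q.1 q.2.1 q.2.2)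
    (sound : ∀ x M T (ψ : FreeGroup (Fin k) →* Equiv.Perm (Fin (M + 1))),
      Represents T ψ → Kill x M T → (FreeGroup.lift s).ker ≤ ψ.ker)
    (complete : ∀ M T (Q : Type) [Group Q] [Group.IsNilpotent Q] (φ : hallQuotient τ →* Q)
      (j : Q →* Equiv.Perm (Fin (M + 1))), 1 ≤ M →
      Represents T ((j.comp φ).comp (FreeGroup.lift s)) → ∃ x, Kill x M T) : False := by
  obtain ⟨g, hg⟩ := exists_words hs (hallMarking τ)
  have hmark : FreeGroup.lift (hallMarking τ) = PresentedGroup.mk _ := by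
    ext; simp; rfl
  rw [hmark] at hg
  -- A decidable witness that the n-th machine does not halt. Running time 1 is excluded separately,
  -- since the relator f_p = f_{p^1} is empty and f_p could survive.
  let P : ℕ → (ℕ × X) × (ℕ × List (List ℕ)) → Prop := fun n q =>
    (1 ∉ τ n ∧ Kill q.1.2 q.2.1 q.2.2) ∧ (q.1.1 = oddPrime n ∧
      (∀ x : Fin k × Bool, ActsTrivially q.2.1 q.2.2 [x, (x.1, !x.2)]) ∧
      ActsTrivially q.2.1 q.2.2 ((iterWord (q.1.1 ^ 2)).flatMap g) ∧
      ¬ ActsTrivially q.2.1 q.2.2 ((fWord q.1.1).flatMap g))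
  have hP : ComputablePred fun x : ℕ × ((ℕ × X) × (ℕ × List (List ℕ))) => P x.1 x.2 := by
    have hp : Primrec fun x : ℕ × ((ℕ × X) × (ℕ × List (List ℕ))) => x.2.1.1 :=
      Primrec.fst.comp (Primrec.fst.comp Primrec.snd)
    have hMT : Primrec fun x : ℕ × ((ℕ × X) × (ℕ × List (List ℕ))) => x.2.2 :=
      Primrec.snd.comp Primrec.snd
    have hM := Primrec.fst.comp hMT
    have hT := Primrec.snd.comp hMT
    have hg' : Primrec₂ fun (_ : ℕ × ((ℕ × X) × (ℕ × List (List ℕ)))) (x : Fin 2 × Bool) => g x :=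
      ((Primrec.dom_finite g).comp Primrec.snd).to₂
    refine computablePred_and (computablePred_and ?_ ?_) (PrimrecPred.computablePred ?_)
    · exact (computablePred_comp hτ.decidable_graph
        (Primrec.pair Primrec.fst (Primrec.const 1)).to_comp).not
    · exact computablePred_comp hKill
        (Primrec.pair (Primrec.snd.comp (Primrec.fst.comp Primrec.snd)) hMT).to_comp
    · refine (primrecRel_eq_oddPrime.comp hp Primrec.fst).and
        (PrimrecPred.and (primrecPred_forall_finite fun x =>
          primrecPred_actsTrivially hM hT (Primrec.const _)) (PrimrecPred.and ?_ (PrimrecPred.not ?_)))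
      · exact primrecPred_actsTrivially hM hT (Primrec.list_flatMap
          (primrec_iterWord.comp (primrec_pow.comp hp (Primrec.const 2))) hg')
      · exact primrecPred_actsTrivially hM hT (Primrec.list_flatMap (primrec_fWord.comp hp) hg')
  have hPn : ∀ n, (∃ q, P n q) ↔ ¬ (τ n).Dom := by
    intro n
    constructor
    · rintro ⟨⟨⟨p, x⟩, M, T⟩, ⟨h1, h2⟩, h3, h4, h5, h6⟩ hdom
      obtain ⟨t, ht⟩ := Part.dom_iff_mem.1 hdom
      have ht1 := hτ.one_le n t ht
      have ht2 : t ≠ 1 := fun h => h1 (h ▸ ht)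
      simp only at h2 h3 h4 h5 h6
      obtain ⟨ψ, hψ⟩ := exists_represented h4
      have hker := sound x M T ψ hψ h2
      rw [hψ.actsTrivially_iff] at h5 h6
      have hsurj : Function.Surjective (FreeGroup.lift s) := by
        rw [← MonoidHom.range_eq_top, FreeGroup.range_lift_eq_closure, hs]
      let φ : hallQuotient τ →* Equiv.Perm (Fin (M + 1)) :=
        (FreeGroup.lift s).liftOfSurjective hsurj ⟨ψ, hker⟩
      have hφ : ∀ w, φ (FreeGroup.lift s w) = ψ w := fun w =>
        (FreeGroup.lift s).liftOfRightInverse_comp_apply _ _ ⟨ψ, hker⟩ w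
      rw [MonoidHom.mem_ker, ← hφ, hg] at h5 h6
      rw [mk_iterWord] at h5
      rw [mk_fWord] at h6
      have hrel : PresentedGroup.mk (hallRelators ∪ haltingRelators τ) (fElt p) =
          PresentedGroup.mk _ (fElt (p ^ t)) := by
        rw [← mul_inv_eq_one, ← map_inv, ← map_mul]
        exact PresentedGroup.one_of_mem (Or.inr ⟨n, t, ht, by rw [h3]⟩)
      apply h6
      rw [hrel]
      have hp3 : 3 ≤ p := h3 ▸ three_le_oddPrime n
      -- As t ≥ 2, the commutator defining f_{p^t} extends the one with p² letters a, which is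
      -- already trivial.
      obtain ⟨m, hm⟩ := Nat.exists_eq_add_of_le
        (Nat.pow_le_pow_right (by omega : 0 < p) (by omega : 2 ≤ t))
      have h7 := iterComm_add_mem_ker (φ.comp (PresentedGroup.mk _)) h5 m
      rw [← hm] at h7
      change (φ.comp (PresentedGroup.mk _)) (fElt (p ^ t)) = 1
      rw [fElt, HeisenbergExt.map_comm, h7]
      simp [comm]
    · intro hdom
      have hnt : ∀ t, t ∉ τ n := fun t ht => hdom (Part.dom_iff_mem.2 ⟨t, ht⟩)
      obtain ⟨Q, _, _, _, φ, hφ1, hφ2⟩ := exists_nilpotent_quotient (τ := τ) (n := n)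
        fun t ht => absurd ht (hnt t)
      -- The regular representation of Q will be used; M ≥ 1 because Q is nontrivial, f_p having
      -- nontrivial image.
      obtain ⟨M, ⟨e⟩⟩ : ∃ M, Nonempty (Q ≃ Fin (M + 1)) := by
        have h0 : 0 < Nat.card Q := Nat.card_pos
        refine ⟨Nat.card Q - 1, ⟨(Finite.equivFin Q).trans (finCongr (by omega))⟩⟩
      have hM : 1 ≤ M := by
        by_contra hM
        obtain rfl : M = 0 := by omega
        have : Subsingleton (Fin (0 + 1)) := inferInstanceAs (Subsingleton (Fin 1))
        exact hφ1 (e.injective (Subsingleton.elim _ _))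
      let j : Q →* Equiv.Perm (Fin (M + 1)) :=
        (e.permCongrHom.toMonoidHom).comp (MulAction.toPermHom Q Q)
      have hj : Function.Injective j :=
        e.permCongrHom.injective.comp MulAction.toPerm_injective
      obtain ⟨T, hT⟩ := exists_represents ((j.comp φ).comp (FreeGroup.lift s))
      obtain ⟨x, hx⟩ := complete M T Q φ j hM hT
      refine ⟨((oddPrime n, x), (M, T)), ⟨hnt 1, hx⟩, rfl, fun y => ?_, ?_, ?_⟩
      · rw [hT.actsTrivially_iff, MonoidHom.mem_ker]
        have : FreeGroup.mk [y, (y.1, !y.2)] = 1 :=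
          FreeGroup.Red.exact.2 ⟨[], FreeGroup.Red.Step.to_red
            (FreeGroup.Red.Step.not (L₁ := [])), .refl⟩
        rw [this, map_one]
      · rw [hT.actsTrivially_iff, MonoidHom.mem_ker, MonoidHom.comp_apply, hg, mk_iterWord,
          MonoidHom.comp_apply, hφ2, map_one]
      · rw [hT.actsTrivially_iff, MonoidHom.mem_ker, MonoidHom.comp_apply, hg, mk_fWord,
          MonoidHom.comp_apply]
        exact fun h => hφ1 (hj (h.trans (map_one j).symm))
  -- Post's theorem: halting and non-halting are both recursively enumerable.
  refine hτ.undecidable_dom (ComputablePred.computable_iff_re_compl_re'.2 ⟨?_, ?_⟩)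
  · exact (rePred_exists (p := fun n t => t ∈ τ n) hτ.decidable_graph).of_eq
      fun n => Part.dom_iff_mem.symm
  · exact (rePred_exists hP).of_eq hPn

/-! ### Nilpotent quotients and EDT0L presentations -/

/-- The certificate is an index n such that the given relators of the n-th nilpotent quotient act
trivially. A representation through a nilpotent group passes this test once the n-th term of that
group's lower central series is trivial. -/
theorem not_computableNilpotentQuotients {τ : ℕ →. ℕ} (hτ : IsHaltingTime τ) :
    ¬ ComputableNilpotentQuotients (hallMarking τ) := by
  rintro ⟨F, hF, hpres⟩
  have hlift : ∀ n, FreeGroup.lift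
      (fun i => (hallMarking τ i : hallQuotient τ ⧸ (⊤ : Subgroup (hallQuotient τ)).lowerCentralSeries n)) =
      (QuotientGroup.mk' _).comp (FreeGroup.lift (hallMarking τ)) := fun n => by ext; simp
  refine false_of_certificates hτ (closure_range_hallMarking τ)
    (fun n M T => ∀ r ∈ F n, ActsTrivially M T r) ?_ ?_ ?_
  · have h : PrimrecPred fun q : List (List (Fin 2 × Bool)) × (ℕ × List (List ℕ)) =>
        ∀ r ∈ q.1, ActsTrivially q.2.1 q.2.2 r :=
      primrecPred_forall_mem Primrec.fst (primrecPred_actsTrivially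
        (Primrec.fst.comp (Primrec.snd.comp Primrec.fst))
        (Primrec.snd.comp (Primrec.snd.comp Primrec.fst)) Primrec.snd)
    exact computablePred_comp h.computablePred
      (Computable.pair (hF.comp Computable.fst) Computable.snd)
  · intro n M T ψ hψ hkill
    have h1 := (hpres n).2
    rw [hlift] at h1
    intro x hx
    have hx' : x ∈ ((QuotientGroup.mk' ((⊤ : Subgroup (hallQuotient τ)).lowerCentralSeries n)).comp
        (FreeGroup.lift (hallMarking τ))).ker := by
      rw [MonoidHom.mem_ker, MonoidHom.comp_apply, MonoidHom.mem_ker.1 hx, map_one]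
    rw [← h1] at hx'
    refine Subgroup.normalClosure_le_normal ?_ hx'
    rintro _ ⟨r, hr, rfl⟩
    exact (hψ.actsTrivially_iff r).1 (hkill r hr)
  · intro M T Q _ hQ φ j _ hT
    obtain ⟨n, hn⟩ := Subgroup.nilpotent_iff_lowerCentralSeries.1 hQ
    refine ⟨n, fun r hr => ?_⟩
    have h1 : FreeGroup.mk r ∈ Subgroup.normalClosure (FreeGroup.mk '' {r | r ∈ F n}) :=
      Subgroup.subset_normalClosure ⟨r, hr, rfl⟩
    rw [(hpres n).2, hlift, MonoidHom.mem_ker, MonoidHom.comp_apply, QuotientGroup.mk'_apply,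
      QuotientGroup.eq_one_iff] at h1
    have h2 := Subgroup.mem_map_of_mem φ h1
    rw [Subgroup.map_lowerCentralSeries] at h2
    have h3 := Subgroup.lowerCentralSeries_mono n (le_top : Subgroup.map φ ⊤ ≤ ⊤) h2
    change _ ∈ (⊤ : Subgroup Q).lowerCentralSeries n at h3
    rw [hn, Subgroup.mem_bot] at h3
    rw [hT.actsTrivially_iff, MonoidHom.mem_ker, MonoidHom.comp_apply, MonoidHom.comp_apply, h3,
      map_one]

/-! ### Certificates from EDT0L presentations -/

theorem prod_map_applyMorphism {B N : Type} [Monoid N] (h : B → List B) (u : List B) (β : B → N) :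
    ((applyMorphism h u).map β).prod = (u.map fun b => ((h b).map β).prod).prod := by
  induction u with
  | nil => rfl
  | cons b u ih =>
    have : applyMorphism h (b :: u) = h b ++ applyMorphism h u := rfl
    rw [this, List.map_append, List.prod_append, ih, List.map_cons, List.prod_cons]

theorem DT0LSystem.seed_mem_language {B : Type} (D : DT0LSystem B) : D.seed ∈ D.language :=
  ⟨[], by simp, rfl⟩

theorem DT0LSystem.applyMorphism_mem_language {B : Type} (D : DT0LSystem B) {h : B → List B}
    (hh : h ∈ D.morphisms) {u : List B} (hu : u ∈ D.language) : applyMorphism h u ∈ D.language := by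
  obtain ⟨c, hc, rfl⟩ := hu
  refine ⟨c ++ [h], fun h' hh' => ?_, by simp⟩
  rcases List.mem_append.1 hh' with h1 | h1
  · exact hc _ h1
  · rw [List.mem_singleton.1 h1]; exact hh

/-- A letter acting by a constant map makes a word act non-injectively. -/
theorem not_injective_of_const {B α : Type} {β : B → Function.End α} {b : B} {x y c : α}
    (hxy : x ≠ y) (hb : ∀ z, β b z = c) {u : List B} (hu : b ∈ u) :
    ¬ Function.Injective ((u.map β).prod : α → α) := by
  obtain ⟨u₁, u₂, rfl⟩ := List.append_of_mem hu
  intro hinj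
  refine hxy (hinj ?_)
  simp only [List.map_append, List.map_cons, List.prod_append, List.prod_cons]
  change (u₁.map β).prod (β b ((u₂.map β).prod x)) = (u₁.map β).prod (β b ((u₂.map β).prod y))
  rw [hb, hb]

section

variable {A : Type} [Primcodable A] {m : ℕ}

/-- The list `𝒯` of tables on the extended alphabet contains an extension of the tables `T`, is
closed under pulling back by the morphisms of the system, and each of its members makes the seed act
trivially or non-injectively. -/
def EDT0LCertificate (D : DT0LSystem (A ⊕ Fin m)) (𝒯 : List (List (List ℕ))) (M : ℕ)
    (T : List (List ℕ)) : Prop :=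
  (∃ T₀ ∈ 𝒯, ∀ a : A, ∀ i < M + 1, act M T₀ (Sum.inl a : A ⊕ Fin m) i = act M T a i) ∧
  (∀ T₁ ∈ 𝒯, ∀ l : Fin D.morphisms.length, ∃ T₂ ∈ 𝒯, ∀ b : A ⊕ Fin m, ∀ i < M + 1,
    act M T₂ b i = actWord M T₁ (D.morphism l b) i) ∧
  (∀ T₁ ∈ 𝒯, ActsTrivially M T₁ D.seed ∨ ∃ i < M + 1, ∃ j < M + 1, i ≠ j ∧
    actWord M T₁ D.seed i = actWord M T₁ D.seed j)

theorem primrecPred_EDT0LCertificate [Finite A] (D : DT0LSystem (A ⊕ Fin m)) :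
    PrimrecPred fun q : List (List (List ℕ)) × (ℕ × List (List ℕ)) =>
      EDT0LCertificate D q.1 q.2.1 q.2.2 := by
  refine PrimrecPred.and ?_ (PrimrecPred.and ?_ ?_)
  · refine primrecPred_exists_mem Primrec.fst (primrecPred_forall_finite fun a => ?_)
    refine primrecPred_forall_lt (Primrec.succ.comp
      (Primrec.fst.comp (Primrec.snd.comp Primrec.fst))) ?_
    have hM : Primrec fun q : ((List (List (List ℕ)) × (ℕ × List (List ℕ))) × List (List ℕ)) × ℕ =>
        q.1.1.2.1 := Primrec.fst.comp (Primrec.snd.comp (Primrec.fst.comp Primrec.fst))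
    exact Primrec.eq.comp
      (primrec_act hM (Primrec.snd.comp Primrec.fst) (Primrec.const _) Primrec.snd)
      (primrec_act hM (Primrec.snd.comp (Primrec.snd.comp (Primrec.fst.comp Primrec.fst)))
        (Primrec.const _) Primrec.snd)
  · refine primrecPred_forall_mem Primrec.fst (primrecPred_forall_finite fun l => ?_)
    refine primrecPred_exists_mem (Primrec.fst.comp Primrec.fst)
      (primrecPred_forall_finite fun b => ?_)
    refine primrecPred_forall_lt (Primrec.succ.comp
      (Primrec.fst.comp (Primrec.snd.comp (Primrec.fst.comp Primrec.fst)))) ?_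
    have hM : Primrec fun q : (((List (List (List ℕ)) × (ℕ × List (List ℕ))) × List (List ℕ)) ×
        List (List ℕ)) × ℕ => q.1.1.1.2.1 :=
      Primrec.fst.comp (Primrec.snd.comp (Primrec.fst.comp (Primrec.fst.comp Primrec.fst)))
    exact Primrec.eq.comp
      (primrec_act hM (Primrec.snd.comp Primrec.fst) (Primrec.const _) Primrec.snd)
      (primrec_actWord hM (Primrec.snd.comp (Primrec.fst.comp Primrec.fst)) (Primrec.const _)
        Primrec.snd)
  · refine primrecPred_forall_mem Primrec.fst (PrimrecPred.or ?_ ?_)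
    · exact primrecPred_actsTrivially (Primrec.fst.comp (Primrec.snd.comp Primrec.fst)) Primrec.snd
        (Primrec.const _)
    · refine primrecPred_exists_lt (Primrec.succ.comp
        (Primrec.fst.comp (Primrec.snd.comp Primrec.fst))) ?_
      refine primrecPred_exists_lt (Primrec.succ.comp
        (Primrec.fst.comp (Primrec.snd.comp (Primrec.fst.comp Primrec.fst)))) ?_
      have hM : Primrec fun q : (((List (List (List ℕ)) × (ℕ × List (List ℕ))) × List (List ℕ)) ×
          ℕ) × ℕ => q.1.1.1.2.1 :=
        Primrec.fst.comp (Primrec.snd.comp (Primrec.fst.comp (Primrec.fst.comp Primrec.fst)))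
      have hT : Primrec fun q : (((List (List (List ℕ)) × (ℕ × List (List ℕ))) × List (List ℕ)) ×
          ℕ) × ℕ => q.1.1.2 := Primrec.snd.comp (Primrec.fst.comp Primrec.fst)
      exact (PrimrecPred.not (Primrec.eq.comp (Primrec.snd.comp Primrec.fst) Primrec.snd)).and
        (Primrec.eq.comp (primrec_actWord hM hT (Primrec.const _) (Primrec.snd.comp Primrec.fst))
          (primrec_actWord hM hT (Primrec.const _) Primrec.snd))

theorem EDT0LCertificate.pullback {D : DT0LSystem (A ⊕ Fin m)} {𝒯 : List (List (List ℕ))} {M : ℕ}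
    {T : List (List ℕ)} (h : EDT0LCertificate D 𝒯 M T) {T₁ : List (List ℕ)} (hT₁ : T₁ ∈ 𝒯)
    {f : A ⊕ Fin m → List (A ⊕ Fin m)} (hf : f ∈ D.morphisms) :
    ∃ T₂ ∈ 𝒯, den M T₂ = fun b => ((f b).map (den M T₁)).prod := by
  obtain ⟨l, hl, rfl⟩ := D.exists_morphism_eq hf
  obtain ⟨T₂, hT₂, h2⟩ := h.2.1 T₁ hT₁ ⟨l, hl⟩
  refine ⟨T₂, hT₂, ?_⟩
  funext b i
  ext
  rw [← actWord_eq]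
  exact h2 b i i.2

/-- Pulling back along the chain of morphisms reduces the word to the seed under another member of
the family. The seed acts trivially or non-injectively, and injectivity excludes the latter. -/
theorem EDT0LCertificate.prod_eq_one {D : DT0LSystem (A ⊕ Fin m)} {𝒯 : List (List (List ℕ))}
    {M : ℕ} {T : List (List ℕ)} (h : EDT0LCertificate D 𝒯 M T) {w : List A}
    (hw : w.map Sum.inl ∈ D.language)
    (hinj : Function.Injective ((w.map (den M T)).prod : Fin (M + 1) → Fin (M + 1))) :
    (w.map (den M T)).prod = 1 := by
  have key : ∀ c : List (A ⊕ Fin m → List (A ⊕ Fin m)), (∀ f ∈ c, f ∈ D.morphisms) →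
      ∀ T₁ ∈ 𝒯, ∃ T₂ ∈ 𝒯, ((c.foldl (fun u f => applyMorphism f u) D.seed).map (den M T₁)).prod =
        (D.seed.map (den M T₂)).prod := by
    intro c
    -- The morphism applied last is the first to be pulled back.
    induction c using List.reverseRecOn with
    | nil => exact fun _ T₁ hT₁ => ⟨T₁, hT₁, rfl⟩
    | append_singleton c f ih =>
      intro hc T₁ hT₁
      obtain ⟨T₂, hT₂, h2⟩ := h.pullback hT₁ (hc f (by simp))
      obtain ⟨T₃, hT₃, h3⟩ := ih (fun f' hf' => hc f' (by simp [hf'])) T₂ hT₂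
      refine ⟨T₃, hT₃, ?_⟩
      rw [List.foldl_append, List.foldl_cons, List.foldl_nil, prod_map_applyMorphism, ← h2, h3]
  obtain ⟨c, hc, hwc⟩ := hw
  obtain ⟨T₀, hT₀, h0⟩ := h.1
  obtain ⟨T₁, hT₁, h1⟩ := key c hc T₀ hT₀
  have h2 : (w.map (den M T)).prod = (D.seed.map (den M T₁)).prod := by
    rw [← h1, ← hwc, List.map_map]
    congr 2
    funext a i
    ext
    exact (h0 a i i.2).symm
  rw [h2] at hinj ⊢
  rcases h.2.2 T₁ hT₁ with h3 | ⟨i, hi, j, hj, hij, h3⟩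
  · exact actsTrivially_iff.1 h3
  · rw [actWord_eq_of_lt M T₁ _ hi, actWord_eq_of_lt M T₁ _ hj] at h3
    exact absurd (congrArg Fin.val (hinj (Fin.ext h3))) hij

theorem exists_EDT0LCertificate [Finite A] (D : DT0LSystem (A ⊕ Fin m)) {M : ℕ} (hM : 1 ≤ M)
    {T : List (List ℕ)}
    (hT : ∀ w : List A, w.map Sum.inl ∈ D.language → (w.map (den M T)).prod = 1) :
    ∃ 𝒯, EDT0LCertificate D 𝒯 M T := by
  -- The largest possible family: it is finite as there are finitely many self-maps, and closed
  -- under pullback as the DT0L language is closed under the morphisms.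
  let S : Set (A ⊕ Fin m → Function.End (Fin (M + 1))) := {β | ∀ u ∈ D.language,
    (u.map β).prod = 1 ∨ ¬ Function.Injective ((u.map β).prod : Fin (M + 1) → Fin (M + 1))}
  have : Finite (Function.End (Fin (M + 1))) := inferInstanceAs (Finite (Fin (M + 1) → Fin (M + 1)))
  choose tab htab using fun β : A ⊕ Fin m → Function.End (Fin (M + 1)) => exists_den_eq M β
  have hmem : ∀ T₁, T₁ ∈ (Set.toFinite S).toFinset.toList.map tab ↔ ∃ β ∈ S, tab β = T₁ := by
    simp
  refine ⟨(Set.toFinite S).toFinset.toList.map tab, ?_, ?_, ?_⟩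
  · let β₀ : A ⊕ Fin m → Function.End (Fin (M + 1)) := Sum.elim (den M T) fun _ _ => 0
    refine ⟨tab β₀, (hmem _).2 ⟨β₀, fun u hu => ?_, rfl⟩, fun a i hi => ?_⟩
    · by_cases h : ∃ b : Fin m, Sum.inr b ∈ u
      · obtain ⟨b, hb⟩ := h
        right
        have h01 : (⟨0, by omega⟩ : Fin (M + 1)) ≠ ⟨1, by omega⟩ := by simp
        exact not_injective_of_const h01 (fun z => rfl) hb
      · left
        obtain ⟨w, rfl⟩ : ∃ w : List A, u = w.map Sum.inl := by
          have : u ∈ Set.range (List.map (Sum.inl : A → A ⊕ Fin m)) := by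
            rw [Set.range_list_map]
            rintro (a | b) hx
            · exact ⟨a, rfl⟩
            · exact absurd ⟨b, hx⟩ h
          obtain ⟨w, hw⟩ := this
          exact ⟨w, hw.symm⟩
        rw [List.map_map]
        exact hT w hu
    · exact congrArg Fin.val (congrFun (congrFun (htab β₀) (Sum.inl a)) ⟨i, hi⟩)
  · intro T₁ hT₁ l
    obtain ⟨β, hβ, rfl⟩ := (hmem _).1 hT₁
    have hl : D.morphism l ∈ D.morphisms := by
      convert List.getElem_mem l.2 using 1
      funext b
      simp [DT0LSystem.morphism]
    let β' : A ⊕ Fin m → Function.End (Fin (M + 1)) := fun b => ((D.morphism l b).map β).prod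
    refine ⟨tab β', (hmem _).2 ⟨β', fun u hu => ?_, rfl⟩, fun b i hi => ?_⟩
    · have := hβ _ (D.applyMorphism_mem_language hl hu)
      rwa [prod_map_applyMorphism] at this
    · rw [actWord_eq_of_lt M _ _ hi, htab]
      exact congrArg Fin.val (congrFun (congrFun (htab β') b) ⟨i, hi⟩)
  · intro T₁ hT₁
    obtain ⟨β, hβ, rfl⟩ := (hmem _).1 hT₁
    refine (hβ _ D.seed_mem_language).imp (fun h => ?_) fun h => ?_
    · rw [actsTrivially_iff, htab, h]
    · obtain ⟨i, j, hij, hne⟩ := Function.not_injective_iff.1 h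
      refine ⟨i, i.2, j, j.2, fun h => hne (Fin.ext h), ?_⟩
      rw [actWord_eq, actWord_eq, htab, hij]

end

theorem hallQuotient_notMem_presented_EDT0L {τ : ℕ →. ℕ} (hτ : IsHaltingTime τ) :
    GrpCat.of (hallQuotient τ) ∉ presented EDT0L := by
  rintro ⟨k, s, R, ⟨m, D, hR⟩, hgen, hker⟩
  change Fin k → hallQuotient τ at s
  refine false_of_certificates hτ (s := s) hgen (EDT0LCertificate D)
    (primrecPred_EDT0LCertificate D).computablePred ?_ ?_
  · intro 𝒯 M T ψ hψ hcert
    refine hker.symm.le.trans (Subgroup.normalClosure_le_normal ?_)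
    rintro _ ⟨w, hw, rfl⟩
    rw [hR] at hw
    refine (hψ.actsTrivially_iff w).1 (actsTrivially_iff.2 (hcert.prod_eq_one hw ?_))
    rw [hψ w]
    exact Equiv.injective _
  · intro M T Q _ _ φ j hM hT
    refine exists_EDT0LCertificate D hM fun w hw => ?_
    rw [← actsTrivially_iff, hT.actsTrivially_iff, MonoidHom.mem_ker, MonoidHom.comp_apply]
    have h1 : FreeGroup.mk w ∈ (FreeGroup.lift s).ker :=
      hker.le (Subgroup.subset_normalClosure ⟨w, by rw [hR]; exact hw, rfl⟩)
    rw [MonoidHom.mem_ker.1 h1, map_one]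

end LangPres

theorem mainTheorem7 :
    (∀ τ : ℕ →. ℕ, LangPres.IsHaltingTime τ →
      GrpCat.of (LangPres.hallQuotient τ) ∈ LangPres.presented LangPres.REC ∧
      ¬ LangPres.ComputableNilpotentQuotients (LangPres.hallMarking τ) ∧
      GrpCat.of (LangPres.hallQuotient τ) ∉ LangPres.presented LangPres.EDT0L) ∧
    LangPres.presented.{u} LangPres.EDT0L ⊂ LangPres.presented.{u} LangPres.REC ∧
    LangPres.presented.{u} LangPres.REC = LangPres.presented.{u} LangPres.RE := by
  open LangPres in
  have hREC : ∀ τ : ℕ →. ℕ, IsHaltingTime τ → GrpCat.of (hallQuotient τ) ∈ presented REC :=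
    fun τ hτ => presented_RE_subset_REC (hallQuotient_mem_presented_RE hτ)
  refine ⟨fun τ hτ => ⟨hREC τ hτ, LangPres.not_computableNilpotentQuotients hτ,
    LangPres.hallQuotient_notMem_presented_EDT0L hτ⟩, ⟨?_, fun h => ?_⟩, ?_⟩
  · exact (LangPres.presented_mono fun _ _ h => LangPres.EDT0L_subset_RE h).trans
      LangPres.presented_RE_subset_REC
  · have hτ := LangPres.codeHaltingTime_isHaltingTime
    -- The separating group lives in the lowest universe and is lifted to `u`, then brought back.
    have h1 := h (LangPres.presented_of_mulEquiv MulEquiv.ulift.symm (hREC _ hτ))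
    exact LangPres.hallQuotient_notMem_presented_EDT0L hτ
      (LangPres.presented_of_mulEquiv MulEquiv.ulift h1)
  · exact LangPres.presented_REC_subset_RE.antisymm LangPres.presented_RE_subset_REC
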